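/- **Lemma (uniform LAN expansion for noiseless ICA with known source densities).** Let $d\ge 0$, let $W_0\in\mathbb R^{d\times d}$ be nonsingular, and let $p_{0,1},\dots,p_{0,d}$ be probability densities on $\mathbb R$; write $\psi_k=(\log p_{0,k})'$. Let $S=(S_1,\dots,S_d)$ have independent coordinates with $S_k\sim p_{0,k}$, and assume: 1. each $p_{0,k}$ is strictly positive and three times continuously differentiable, and $s\,p_{0,k}(s)\to0$ as $|s|\to\infty$; 2. $\mathbb E[S_k^2]<\infty$, $\mathbb E[(1+S_k^2)\psi_k(S_k)^2]<\infty$ and $\mathbb E[(1+S_k^2)|\psi_k'(S_k)|]<\infty$ for every $k$; 3. there are $\delta>0$ and functions $G_k:\mathbb R\to\mathbb R$ with $|\psi_k''(u)|\le G_k(s)$ whenever $|u-s|\le\delta$, and $\mathbb E\big[(1+\|S\|^3)\sum_{k=1}^d G_k(S_k)\big]<\infty$. Let $X^{(1)},X^{(2)},\dots$ be i.i.d. with the law $P_0$ of $X=W_0^{-1}S$. For $\theta=\mathrm{vec}(W)\in\mathbb R^{d^2}$ with $W$ having rows $w_k^\top$, put $$\ell(\theta;x)=\log|\det W|+\sum_{k=1}^d\log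 p_{0,k}(w_k^\top x),\qquad L_N(\theta)=\sum_{i=1}^N\ell(\theta;X^{(i)}),$$ and let $\theta_0=\mathrm{vec}(W_0)$, $$S_N=\frac1{\sqrt N}\sum_{i=1}^N\nabla_\theta\ell(\theta_0;X^{(i)}),\qquad \mathcal I=\mathrm{Cov}_{P_0}\big(\nabla_\theta\ell(\theta_0;X)\big).$$ Then: * the score $\nabla_\theta\ell(\theta_0;X)$ is square integrable and the Hessian $\nabla^2_\theta\ell(\theta_0;X)$ is integrable under $P_0$, and $\mathcal I=-\mathbb E_{P_0}[\nabla_\theta^2\ell(\theta_0;X)]$ is positive semidefinite; * $S_N$ converges in law to $\mathcal N(0,\mathcal I)$ as $N\to\infty$; * for every $R>0$, $$\sup_{\|h\|\le R}\Big|L_N\big(\theta_0+h/\sqrt N\big)-L_N(\theta_0)-\Big(h^\top S_N-\tfrac12h^\top\mathcal I h\Big)\Big|\longrightarrow0\quad\text{in }P_0\text{-probability as }N\to\infty.$$ -/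

import Mathlib

open MeasureTheory ProbabilityTheory Filter Topology Matrix

namespace ICA

noncomputable section

/-- The parameter space `ℝ^{d²}` of the vectorized unmixing matrix, with its Euclidean norm. -/
abbrev Param (d : ℕ) : Type := EuclideanSpace ℝ (Fin d × Fin d)

/-- `θ = vec(W)` (columns stacked, as in `Matrix.vec`). -/
def vecW {d : ℕ} (W : Matrix (Fin d) (Fin d) ℝ) : Param d := WithLp.toLp 2 W.vec

/-- The inverse vectorization `θ ↦ W(θ)`. -/
def matW {d : ℕ} (θ : Param d) : Matrix (Fin d) (Fin d) ℝ := Matrix.of fun i j => θ (j, i)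

theorem matW_vecW {d : ℕ} (W : Matrix (Fin d) (Fin d) ℝ) : matW (vecW W) = W := rfl

theorem vecW_matW {d : ℕ} (θ : Param d) : vecW (matW θ) = θ := rfl

/-- The probability measure on `ℝ` with Lebesgue density `q`. -/
def densityLaw (q : ℝ → ℝ) : Measure ℝ := volume.withDensity fun s => ENNReal.ofReal (q s)

/-- The law of the source vector `S = (S_1, …, S_d)`: independent coordinates, `S_k` with
density `p k`. -/
def sourceLaw {d : ℕ} (p : Fin d → ℝ → ℝ) : Measure (Fin d → ℝ) :=
  Measure.pi fun k => densityLaw (p k)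

/-- The law `P₀` of one observation `X = W₀⁻¹ S` of the noiseless model. -/
def dataLaw {d : ℕ} (p : Fin d → ℝ → ℝ) (W₀ : Matrix (Fin d) (Fin d) ℝ) : Measure (Fin d → ℝ) :=
  (sourceLaw p).map fun s => W₀⁻¹ *ᵥ s

/-- The source score function `ψ = (log q)'`. -/
def psi (q : ℝ → ℝ) : ℝ → ℝ := deriv fun s => Real.log (q s)

/-- The regularity, moment and envelope assumptions on the known source densities. -/
structure SourceAssumptions {d : ℕ} (p : Fin d → ℝ → ℝ) : Prop where
  /-- Each `p k` is positive, three times continuously differentiable, integrates to one, and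
  satisfies `s p_k(s) → 0` as `|s| → ∞`. -/
  pos : ∀ k s, 0 < p k s
  contDiff : ∀ k, ContDiff ℝ 3 (p k)
  integrable : ∀ k, Integrable (p k)
  integral_eq_one : ∀ k, ∫ s, p k s = 1
  tail_top : ∀ k, Tendsto (fun s => s * p k s) atTop (𝓝 0)
  tail_bot : ∀ k, Tendsto (fun s => s * p k s) atBot (𝓝 0)
  /-- Moments: `E S_k² < ∞`, `E[(1 + S_k²) ψ_k(S_k)²] < ∞`, `E[(1 + S_k²) |ψ_k'(S_k)|] < ∞`. -/
  moment_sq : ∀ k, Integrable (fun s : ℝ => s ^ 2) (densityLaw (p k))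
  moment_psi : ∀ k, Integrable (fun s => (1 + s ^ 2) * psi (p k) s ^ 2) (densityLaw (p k))
  moment_dpsi : ∀ k, Integrable (fun s => (1 + s ^ 2) * |deriv (psi (p k)) s|) (densityLaw (p k))
  /-- Local envelopes: `|ψ_k''(u)| ≤ G_k(S_k)` whenever `|u - S_k| ≤ δ`, with
  `E[(1 + ‖S‖³) ∑_k G_k(S_k)] < ∞`, where `‖S‖` is the Euclidean norm. -/
  envelope : ∃ δ > 0, ∃ G : Fin d → ℝ → ℝ,
    (∀ k s u, |u - s| ≤ δ → |deriv (deriv (psi (p k))) u| ≤ G k s) ∧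
    Integrable (fun s : Fin d → ℝ => (1 + ‖WithLp.toLp 2 s‖ ^ 3) * ∑ k, G k (s k)) (sourceLaw p)

/-- The log-likelihood `ℓ(W; x) = log |det W| + ∑_k log p_k(w_kᵀ x)` of one observation, as a
function of `θ = vec(W)`. -/
def logLik {d : ℕ} (p : Fin d → ℝ → ℝ) (x : Fin d → ℝ) (θ : Param d) : ℝ :=
  Real.log |(matW θ).det| + ∑ k, Real.log (p k ((matW θ *ᵥ x) k))

/-- The log-likelihood `L_N(θ)` of the sample `x 0, …, x (N - 1)`. -/
def sampleLogLik {d : ℕ} (p : Fin d → ℝ → ℝ) (N : ℕ) (x : ℕ → Fin d → ℝ) (θ : Param d) : ℝ :=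
  ∑ i ∈ Finset.range N, logLik p (x i) θ

/-- The score `∇_θ ℓ(θ; x)` of one observation. -/
def score {d : ℕ} (p : Fin d → ℝ → ℝ) (θ : Param d) (x : Fin d → ℝ) : Param d :=
  gradient (logLik p x) θ

/-- The Hessian matrix `∇_θ² ℓ(θ; x)` of one observation. -/
def hessian {d : ℕ} (p : Fin d → ℝ → ℝ) (θ : Param d) (x : Fin d → ℝ) :
    Matrix (Fin d × Fin d) (Fin d × Fin d) ℝ :=
  Matrix.of fun a b => fderiv ℝ (fderiv ℝ (logLik p x)) θ
    (EuclideanSpace.single a 1) (EuclideanSpace.single b 1)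

/-- The normalized score `S_N = N^{-1/2} ∑_{i < N} ∇_θ ℓ(θ; x i)`. -/
def normScore {d : ℕ} (p : Fin d → ℝ → ℝ) (θ : Param d) (N : ℕ) (x : ℕ → Fin d → ℝ) : Param d :=
  (√(N : ℝ))⁻¹ • ∑ i ∈ Finset.range N, score p θ (x i)

/-- The Fisher information for `vec(W)` at `W₀`: the covariance matrix of `∇_θ ℓ(θ₀; X)` under
`P₀`. -/
def fisherInfo {d : ℕ} (p : Fin d → ℝ → ℝ) (W₀ : Matrix (Fin d) (Fin d) ℝ) :
    Matrix (Fin d × Fin d) (Fin d × Fin d) ℝ :=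
  Matrix.of fun a b =>
    covariance (fun x => score p (vecW W₀) x a) (fun x => score p (vecW W₀) x b) (dataLaw p W₀)

/-- The remainder
`r_N(h) = L_N(θ₀ + h / √N) - L_N(θ₀) - (hᵀ S_N - ½ hᵀ I h)` of the expansion. -/
def lanRemainder {d : ℕ} (p : Fin d → ℝ → ℝ) (W₀ : Matrix (Fin d) (Fin d) ℝ) (N : ℕ)
    (x : ℕ → Fin d → ℝ) (h : Param d) : ℝ :=
  sampleLogLik p N x (vecW W₀ + (√(N : ℝ))⁻¹ • h) - sampleLogLik p N x (vecW W₀)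
    - (inner ℝ h (normScore p (vecW W₀) N x) - 1 / 2 * (h.ofLp ⬝ᵥ fisherInfo p W₀ *ᵥ h.ofLp))

end

end ICA

namespace ICA

noncomputable section

/-! In the coordinates `s = W₀ x` the score and the Hessian at `W₀` are fixed linear combinations,
with coefficients from `W₀⁻¹`, of `relScore` and `relHess`, which depend on independent sources
only. Their integrability follows from the moment assumptions and independence.

The information identity is Stein's identity `E[ψ_i(S_i) f(S)] = -E[∂_i f(S)]`. Taking `f = s_l`
shows that the score is centred; taking `f = ψ_k(s_k) s_l s_m` matches its second moments with minus
the mean Hessian. The central limit theorem for the score follows by projecting on a fixed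
direction.

For the expansion, put `v = h / √N` and expand each log-likelihood to second order. The
log-determinant is deterministic and smooth, so its `N` equal remainders add up to `o(1)` on a ball.
For the source terms the envelope bounds the third derivative of `log p_k` as long as the arguments
move by at most `δ`; this holds for all `i < N` with probability tending to one, because `E‖S‖² < ∞`
makes `max ‖S_i‖` of order `o(√N)`. The cubic remainders then sum to `N^{-1/2}` times an average of
envelopes, and the averaged Hessian tends to `-I`, both by the law of large numbers. Every bound
sees `h` only through `‖h‖ ≤ R`, whence uniformity (`abs_lanRemainder_le`). -/

/-! ### Probabilistic tools -/

/-- The multivariate central limit theorem for centred i.i.d. square-integrable vectors. -/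
theorem tendstoInDistribution_multivariateGaussian {ι Ω : Type*} [Fintype ι] [DecidableEq ι]
    [MeasurableSpace Ω] {P : Measure Ω} [IsProbabilityMeasure P]
    {Z : ℕ → Ω → EuclideanSpace ℝ ι} (hindep : iIndepFun Z P)
    (hident : ∀ i, IdentDistrib (Z i) (Z 0) P P)
    (hL : ∀ a, MemLp (fun ω => Z 0 ω a) 2 P) (h0 : ∀ a, ∫ ω, Z 0 ω a ∂P = 0)
    {S : Matrix ι ι ℝ} (hS : S.PosSemidef)
    (hcov : ∀ a b, S a b = covariance (fun ω => Z 0 ω a) (fun ω => Z 0 ω b) P) :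
    TendstoInDistribution (fun (N : ℕ) ω => (√(N : ℝ))⁻¹ • ∑ i ∈ Finset.range N, Z i ω) atTop id
      (fun _ => P) (multivariateGaussian 0 S) where
  forall_aemeasurable n :=
    (Finset.aemeasurable_fun_sum _ fun i _ => (hident i).aemeasurable_fst).fun_const_smul _
  tendsto := by
    have mZ i := (hident i).aemeasurable_fst
    refine ProbabilityMeasure.tendsto_iff_tendsto_charFun.2 fun t => ?_
    have hexp (z : EuclideanSpace ℝ ι) : inner ℝ t z = ∑ a, t a * z a := by
      simp [PiLp.inner_apply, mul_comm]
    let Y : ℕ → Ω → ℝ := fun i ω => inner ℝ t (Z i ω)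
    have hmeas : Measurable fun z : EuclideanSpace ℝ ι => (inner ℝ t z : ℝ) := by fun_prop
    have hYi : iIndepFun Y P := hindep.comp (fun _ z => inner ℝ t z) fun _ => hmeas
    have hYd i : IdentDistrib (Y i) (Y 0) P P := (hident i).comp hmeas
    have hYe : Y 0 = fun ω => ∑ a, t a * Z 0 ω a := funext fun ω => hexp _
    have hYL : MemLp (Y 0) 2 P := by
      rw [hYe]; exact memLp_finsetSum _ fun a _ => (hL a).const_mul _
    have hY0 : P[Y 0] = 0 := by
      rw [hYe, integral_finsetSum _ fun a _ => ((hL a).integrable (by norm_num)).const_mul _]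
      simp [integral_const_mul, h0]
    have hYv : Var[Y 0; P] = t.ofLp ⬝ᵥ S *ᵥ t.ofLp := by
      rw [← covariance_self hYL.1.aemeasurable, hYe,
        covariance_fun_sum_fun_sum (fun a => (hL a).const_mul _) fun a => (hL a).const_mul _]
      simp only [covariance_const_mul_left, covariance_const_mul_right, ← hcov, dotProduct, mulVec,
        Finset.mul_sum]
      exact Finset.sum_congr rfl fun a _ => Finset.sum_congr rfl fun b _ => by ring
    have hclt := tendstoInDistribution_inv_sqrt_mul_sum_sub (Y := id)
      (P' := gaussianReal 0 Var[Y 0; P].toNNReal) ⟨aemeasurable_id, by simp⟩ hYL hYi hYd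
    -- Cramér–Wold: the characteristic function of the projected sum at frequency `1` is that of the
    -- vector sum at `t`.
    have h1 := ProbabilityMeasure.tendsto_iff_tendsto_charFun.1 hclt.tendsto 1
    simp only [hY0, mul_zero, sub_zero, ProbabilityMeasure.coe_mk, Measure.map_id,
      charFun_gaussianReal, charFun_multivariateGaussian hS] at h1 ⊢
    have hv : 0 ≤ t.ofLp ⬝ᵥ S *ᵥ t.ofLp := hYv ▸ variance_nonneg _ _
    rw [hYv] at h1
    convert h1 using 2 with n
    · have hm : AEMeasurable (fun ω => (√(n : ℝ))⁻¹ • ∑ i ∈ Finset.range n, Z i ω) P :=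
        (Finset.aemeasurable_fun_sum _ fun i _ => mZ i).fun_const_smul _
      have hm' : AEMeasurable (fun ω => (√(n : ℝ))⁻¹ * ∑ i ∈ Finset.range n, Y i ω) P :=
        (Finset.aemeasurable_fun_sum _ fun i _ => (hYd i).aemeasurable_fst).const_mul _
      rw [charFun_apply, charFun_apply, integral_map hm (by fun_prop),
        integral_map hm' (by fun_prop)]
      refine integral_congr_ae (ae_of_all _ fun ω => ?_)
      simp [Y, inner_smul_right, inner_sum, real_inner_comm t, Finset.mul_sum]
    · simp [Real.coe_toNNReal _ hv]

/-- If `Y ≥ 0` is integrable, then `N · μ(Y ≥ c N) → 0`. -/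
theorem tendsto_mul_measure_ge {α : Type*} [MeasurableSpace α] {μ : Measure α} [IsFiniteMeasure μ]
    {Y : α → ℝ} (hY : Integrable Y μ) (hm : Measurable Y) {c : ℝ} (hc : 0 < c) :
    Tendsto (fun N : ℕ => (N : ENNReal) * μ {s | c * N ≤ Y s}) atTop (𝓝 0) := by
  have hms (N : ℕ) : MeasurableSet {s | c * (N : ℝ) ≤ Y s} := measurableSet_le (by fun_prop) hm
  -- Applying Markov's inequality to the truncated variable, whose expectation vanishes in the
  -- limit, improves `O(1)` to `o(1)`.
  have hlim : Tendsto (fun N : ℕ => ∫ s, Set.indicator {s | c * (N : ℝ) ≤ Y s} Y s ∂μ) atTop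
      (𝓝 (∫ _, (0 : ℝ) ∂μ)) := by
    refine tendsto_integral_of_dominated_convergence (fun s => |Y s|)
      (fun N => (hY.indicator (hms N)).1) hY.abs
      (fun N => ae_of_all _ fun s => by
        simpa using norm_indicator_le_norm_self (s := {s | c * (N : ℝ) ≤ Y s}) Y s)
      (ae_of_all _ fun s => ?_)
    obtain ⟨n, hn⟩ := exists_nat_gt (Y s / c)
    refine tendsto_const_nhds.congr' ?_
    filter_upwards [eventually_ge_atTop n] with N hN
    rw [Set.indicator_of_notMem]
    simp only [Set.mem_ofPred_eq, not_le]
    rw [div_lt_iff₀ hc] at hn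
    have : (n : ℝ) ≤ N := by exact_mod_cast hN
    nlinarith
  rw [integral_zero] at hlim
  have hb (N : ℕ) : (N : ENNReal) * μ {s | c * N ≤ Y s} ≤
      ENNReal.ofReal (c⁻¹ * ∫ s, Set.indicator {s | c * (N : ℝ) ≤ Y s} Y s ∂μ) := by
    have h1 : (N : ℝ) * μ.real {s | c * N ≤ Y s} ≤
        c⁻¹ * ∫ s, Set.indicator {s | c * (N : ℝ) ≤ Y s} Y s ∂μ := by
      rw [integral_indicator (hms N), inv_mul_eq_div, le_div_iff₀ hc]
      have := setIntegral_ge_of_const_le_real (μ := μ) (hms N) (measure_ne_top _ _)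
        (fun s hs => hs) hY.integrableOn
      linarith
    have h2 := ENNReal.ofReal_le_ofReal h1
    rwa [ENNReal.ofReal_mul (by positivity), ENNReal.ofReal_natCast, Measure.real,
      ENNReal.ofReal_toReal (measure_ne_top _ _)] at h2
  refine tendsto_of_tendsto_of_tendsto_of_le_of_le tendsto_const_nhds ?_ (fun _ => bot_le) hb
  simpa using ENNReal.tendsto_ofReal (hlim.const_mul c⁻¹)

/-! ### Taylor expansions -/

/-- Second-order Taylor expansion of a `C²` function on a normed space. -/
theorem taylor_two_isLittleO {E : Type*} [NormedAddCommGroup E] [NormedSpace ℝ E] {f : E → ℝ}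
    {x : E} (hf : ContDiffAt ℝ 2 f x) :
    (fun v => f (x + v) - f x - fderiv ℝ f x v - 1 / 2 * fderiv ℝ (fderiv ℝ f) x v v)
      =o[𝓝 0] fun v => ‖v‖ ^ 2 := by
  have hd : DifferentiableAt ℝ (fderiv ℝ f) x :=
    (hf.fderiv_right (m := 1) (by norm_num)).differentiableAt (by norm_num)
  have hev : ∀ᶠ y in 𝓝 x, DifferentiableAt ℝ f y :=
    (hf.eventually (by simp)).mono fun y hy => hy.differentiableAt (by norm_num)
  rw [Asymptotics.isLittleO_iff]
  intro c hc
  have h1 := (hasFDerivAt_iff_isLittleO_nhds_zero.1 hd.hasFDerivAt).def hc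
  have h2 : ∀ᶠ v in 𝓝 (0 : E), DifferentiableAt ℝ f (x + v) := by
    have : Tendsto (fun v => x + v) (𝓝 0) (𝓝 x) := by
      simpa using (continuous_const.add continuous_id).tendsto (x := (0 : E)) (f := fun v => x + v)
    exact this.eventually hev
  obtain ⟨r, hr, hball⟩ := Metric.eventually_nhds_iff_ball.1 (h1.and h2)
  filter_upwards [Metric.ball_mem_nhds 0 hr] with v hv
  have hmem : ∀ t ∈ Set.Icc (0 : ℝ) 1, t • v ∈ Metric.ball (0 : E) r := fun t ht => by
    rw [mem_ball_zero_iff, norm_smul, Real.norm_of_nonneg ht.1] at *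
    nlinarith [norm_nonneg v, ht.2]
  -- Removing the linear and quadratic terms along the segment leaves as derivative the first-order
  -- remainder of `fderiv ℝ f`, applied to `v`. Its smallness is differentiability of `fderiv ℝ f`
  -- at `x`, and the mean value inequality concludes.
  let φ : ℝ → ℝ := fun t =>
    f (x + t • v) - t * fderiv ℝ f x v - t ^ 2 * (1 / 2 * fderiv ℝ (fderiv ℝ f) x v v)
  let φ' : ℝ → ℝ := fun t =>
    (fderiv ℝ f (x + t • v) - fderiv ℝ f x - fderiv ℝ (fderiv ℝ f) x (t • v)) v
  have hφ : ∀ t ∈ Set.Icc (0 : ℝ) 1, HasDerivWithinAt φ (φ' t) (Set.Icc 0 1) t := fun t ht => by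
    have hl : HasDerivAt (fun t : ℝ => x + t • v) v t := by
      simpa using ((hasDerivAt_id t).smul_const v).const_add x
    have h := (((hball _ (hmem t ht)).2.hasFDerivAt.comp_hasDerivAt t hl).sub
      ((hasDerivAt_id t).mul_const (fderiv ℝ f x v))).sub
      ((hasDerivAt_pow 2 t).mul_const (1 / 2 * fderiv ℝ (fderiv ℝ f) x v v))
    refine (h.congr_deriv ?_).hasDerivWithinAt
    simp [φ']
    ring
  have hb : ∀ t ∈ Set.Ico (0 : ℝ) 1, ‖φ' t‖ ≤ c * ‖v‖ ^ 2 := fun t ht => by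
    have ht' := Set.Ico_subset_Icc_self ht
    calc ‖φ' t‖ ≤ ‖_‖ * ‖v‖ := ContinuousLinearMap.le_opNorm _ _
      _ ≤ c * ‖t • v‖ * ‖v‖ := by gcongr; exact (hball _ (hmem t ht')).1
      _ ≤ c * (1 * ‖v‖) * ‖v‖ := by
        rw [norm_smul, Real.norm_of_nonneg ht.1]; gcongr; exact ht.2.le
      _ = c * ‖v‖ ^ 2 := by ring
  have h := norm_image_sub_le_of_norm_deriv_le_segment' hφ hb 1 (by simp)
  rw [Real.norm_of_nonneg (by positivity : 0 ≤ ‖v‖ ^ 2)]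
  have he : φ 1 - φ 0 =
      f (x + v) - f x - fderiv ℝ f x v - 1 / 2 * fderiv ℝ (fderiv ℝ f) x v v := by
    simp [φ]; ring
  rw [← he]
  simpa using h

/-- Second-order Taylor expansion on the line with a local bound on the third derivative. -/
theorem abs_taylor_two_le {g : ℝ → ℝ} (hg : ContDiff ℝ 3 g) {a u C : ℝ}
    (hC : ∀ y, |y - a| ≤ |u| → |deriv (deriv (deriv g)) y| ≤ C) :
    |g (a + u) - g a - deriv g a * u - 1 / 2 * deriv (deriv g) a * u ^ 2| ≤ C * |u| ^ 3 := by
  -- For `u = 0` the interval is a point, on which derivatives within a set are not unique.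
  rcases eq_or_ne u 0 with rfl | hu
  · simp
  obtain ⟨y, hy, h⟩ := taylor_mean_remainder_lagrange_iteratedDeriv (f := g) (n := 2) (x₀ := a)
    (x := a + u) (by simpa using hu) (by exact_mod_cast hg.contDiffOn)
  have hun : UniqueDiffOn ℝ (Set.uIcc a (a + u)) := uniqueDiffOn_uIcc (by simpa using hu)
  have hmem : a ∈ Set.uIcc a (a + u) := Set.left_mem_uIcc
  have e (n : ℕ) (hn : n ≤ 3) : iteratedDerivWithin n g (Set.uIcc a (a + u)) a
      = iteratedDeriv n g a :=
    iteratedDerivWithin_eq_iteratedDeriv hun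
      (hg.contDiffAt.of_le (by exact_mod_cast hn)) hmem
  simp only [taylorWithinEval_succ, taylor_within_zero_eval, e 1 (by norm_num),
    e 2 (by norm_num)] at h
  simp only [iteratedDeriv_succ, iteratedDeriv_zero] at h
  have hle : |deriv (deriv (deriv g)) y| ≤ C := hC y (by
    have := Set.abs_sub_left_of_mem_uIcc (Set.uIoo_subset_uIcc_self hy)
    simpa using this)
  have h3 : g (a + u) - g a - deriv g a * u - 1 / 2 * deriv (deriv g) a * u ^ 2
      = deriv (deriv (deriv g)) y * u ^ 3 / 6 := by
    norm_num [Nat.factorial] at h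
    linarith
  rw [h3, abs_div, abs_mul, abs_pow, abs_of_pos (by norm_num : (0 : ℝ) < 6)]
  have : |deriv (deriv (deriv g)) y| * |u| ^ 3 ≤ C * |u| ^ 3 := by gcongr
  have h0 : 0 ≤ |deriv (deriv (deriv g)) y| * |u| ^ 3 := by positivity
  linarith

/-! ### One source density -/

theorem isProbabilityMeasure_densityLaw {q : ℝ → ℝ} (h0 : ∀ s, 0 < q s) (hi : Integrable q)
    (h1 : ∫ s, q s = 1) : IsProbabilityMeasure (densityLaw q) := by
  constructor
  rw [densityLaw, withDensity_apply _ .univ, Measure.restrict_univ,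
    ← ofReal_integral_eq_lintegral_ofReal hi (ae_of_all _ fun s => (h0 s).le), h1]
  simp

theorem integral_densityLaw {q : ℝ → ℝ} (h0 : ∀ s, 0 < q s) (hc : Continuous q) (g : ℝ → ℝ) :
    ∫ s, g s ∂(densityLaw q) = ∫ s, q s * g s := by
  rw [densityLaw, integral_withDensity_eq_integral_toReal_smul (by fun_prop) (by simp)]
  simp [ENNReal.toReal_ofReal (h0 _).le]

theorem integrable_densityLaw {q : ℝ → ℝ} (h0 : ∀ s, 0 < q s) (hc : Continuous q) {g : ℝ → ℝ} :
    Integrable g (densityLaw q) ↔ Integrable fun s => q s * g s := by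
  rw [densityLaw, integrable_withDensity_iff_integrable_smul₀' (by fun_prop) (by simp)]
  simp [ENNReal.toReal_ofReal (h0 _).le]

theorem contDiff_psi {q : ℝ → ℝ} (h0 : ∀ s, 0 < q s) (hc : ContDiff ℝ 3 q) :
    ContDiff ℝ 2 (psi q) :=
  (ContDiff.log hc fun s => (h0 s).ne').deriv'

theorem hasDerivAt_psi_mul {q : ℝ → ℝ} (h0 : ∀ s, 0 < q s) (hc : ContDiff ℝ 3 q) (s : ℝ) :
    HasDerivAt q (psi q s * q s) s := by
  have hq : DifferentiableAt ℝ q s := (hc.differentiable (by norm_num)) s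
  have h : psi q s = deriv q s / q s := by
    rw [psi, (hq.hasDerivAt.log (h0 s).ne').deriv]
  rw [h, div_mul_cancel₀ _ (h0 s).ne']
  exact hq.hasDerivAt

/-- Stein's identity for a density with score `ψ`: `E[ψ(S) f(S) + f'(S)] = 0`. -/
theorem integral_psi_mul_add_deriv {q : ℝ → ℝ} (h0 : ∀ s, 0 < q s) (hc : ContDiff ℝ 3 q)
    {f f' : ℝ → ℝ} (hf : ∀ s, HasDerivAt f (f' s) s) (hi : Integrable f (densityLaw q))
    (hi' : Integrable (fun s => psi q s * f s + f' s) (densityLaw q)) :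
    ∫ s, psi q s * f s + f' s ∂(densityLaw q) = 0 := by
  rw [integrable_densityLaw h0 hc.continuous] at hi hi'
  rw [integral_densityLaw h0 hc.continuous]
  -- Both `q f` and its derivative `q (ψ f + f')` are integrable on the line, which forces the
  -- boundary terms to vanish.
  refine integral_eq_zero_of_hasDerivAt_of_integrable (f := fun s => q s * f s) (fun s => ?_) hi' hi
  exact ((hasDerivAt_psi_mul h0 hc s).mul (hf s)).congr_deriv (by ring)

/-! ### Independent sources -/

variable {d : ℕ} {p : Fin d → ℝ → ℝ}

theorem SourceAssumptions.isProbabilityMeasure (hp : SourceAssumptions p) (k : Fin d) :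
    IsProbabilityMeasure (densityLaw (p k)) :=
  isProbabilityMeasure_densityLaw (hp.pos k) (hp.integrable k) (hp.integral_eq_one k)

theorem SourceAssumptions.isProbabilityMeasure_sourceLaw (hp : SourceAssumptions p) :
    IsProbabilityMeasure (sourceLaw p) := by
  have := hp.isProbabilityMeasure
  unfold sourceLaw
  infer_instance

theorem SourceAssumptions.contDiff_psi (hp : SourceAssumptions p) (k : Fin d) :
    ContDiff ℝ 2 (psi (p k)) :=
  ICA.contDiff_psi (hp.pos k) (hp.contDiff k)

theorem SourceAssumptions.continuous_psi (hp : SourceAssumptions p) (k : Fin d) :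
    Continuous (psi (p k)) :=
  (hp.contDiff_psi k).continuous

theorem SourceAssumptions.continuous_deriv_psi (hp : SourceAssumptions p) (k : Fin d) :
    Continuous (deriv (psi (p k))) :=
  (hp.contDiff_psi k).continuous_deriv (by norm_num)

theorem SourceAssumptions.measurePreserving_eval (hp : SourceAssumptions p) (k : Fin d) :
    MeasurePreserving (Function.eval k) (sourceLaw p) (densityLaw (p k)) :=
  have := hp.isProbabilityMeasure
  MeasureTheory.measurePreserving_eval _ k

theorem SourceAssumptions.integrable_eval (hp : SourceAssumptions p) {k : Fin d} {f : ℝ → ℝ}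
    (hf : Integrable f (densityLaw (p k))) : Integrable (fun s => f (s k)) (sourceLaw p) :=
  (hp.measurePreserving_eval k).integrable_comp_of_integrable hf

theorem SourceAssumptions.integrable_mul_eval (hp : SourceAssumptions p) {k l : Fin d}
    (hkl : k ≠ l) {f g : ℝ → ℝ} (hfc : Continuous f) (hgc : Continuous g)
    (hf : Integrable f (densityLaw (p k))) (hg : Integrable g (densityLaw (p l))) :
    Integrable (fun s => f (s k) * g (s l)) (sourceLaw p) := by
  have := hp.isProbabilityMeasure
  have hind : iIndepFun (fun (i : Fin d) (s : Fin d → ℝ) => s i) (sourceLaw p) :=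
    iIndepFun_pi (X := fun _ x => x) fun _ => aemeasurable_id
  exact ((hind.indepFun hkl).comp hfc.measurable hgc.measurable).integrable_mul
    (hp.integrable_eval hf) (hp.integrable_eval hg)

/-- Stein's identity in the `i`-th coordinate of a vector of independent sources. -/
theorem SourceAssumptions.integral_psi_mul_add_partial (hp : SourceAssumptions p) (i : Fin d)
    {f f' : (Fin d → ℝ) → ℝ} (hf : ∀ s, HasDerivAt (fun t => f (Function.update s i t)) (f' s) (s i))
    (hi : Integrable f (sourceLaw p))
    (hi' : Integrable (fun s => psi (p i) (s i) * f s + f' s) (sourceLaw p)) :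
    ∫ s, psi (p i) (s i) * f s + f' s ∂(sourceLaw p) = 0 := by
  have := hp.isProbabilityMeasure
  cases d with
  | zero => exact i.elim0
  | succ n =>
    set e := MeasurableEquiv.piFinSuccAbove (fun _ : Fin (n + 1) => ℝ) i
    have he : MeasurePreserving e (sourceLaw p)
        ((densityLaw (p i)).prod (Measure.pi fun j => densityLaw (p (i.succAbove j)))) :=
      measurePreserving_piFinSuccAbove _ i
    have hs : MeasurePreserving e.symm _ _ := he.symm
    have hi2 := (hs.integrable_comp_emb e.symm.measurableEmbedding).2 hi
    have hi2' := (hs.integrable_comp_emb e.symm.measurableEmbedding).2 hi'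
    rw [← hs.integral_comp' (g := fun s => psi (p i) (s i) * f s + f' s)]
    -- Fubini with the `i`-th coordinate innermost: for almost every choice `r` of the others, the
    -- inner integral is a one-dimensional Stein identity.
    refine (integral_prod_symm _ hi2').trans ?_
    refine integral_eq_zero_of_ae ?_
    filter_upwards [hi2.prod_left_ae, hi2'.prod_left_ae] with r h h'
    have hev (t : ℝ) : e.symm (t, r) = i.insertNth (α := fun _ => ℝ) t r := rfl
    simp only [Function.comp_apply, hev, Fin.insertNth_apply_same] at h h' ⊢
    refine integral_psi_mul_add_deriv (hp.pos i) (hp.contDiff i) (fun t => ?_) h h'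
    have h3 := hf (i.insertNth (α := fun _ => ℝ) t r)
    simpa only [Fin.update_insertNth, Fin.insertNth_apply_same] using h3

theorem SourceAssumptions.memLp_eval (hp : SourceAssumptions p) (l : Fin d) :
    MemLp (fun s => s l) 2 (sourceLaw p) :=
  (memLp_two_iff_integrable_sq (Continuous.aestronglyMeasurable (by fun_prop))).2
    (hp.integrable_eval (hp.moment_sq l))

theorem SourceAssumptions.integrable_psi_sq (hp : SourceAssumptions p) (k : Fin d) :
    Integrable (fun s => psi (p k) s ^ 2) (densityLaw (p k)) := by
  have := hp.continuous_psi k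
  refine (hp.moment_psi k).mono' (by fun_prop) (ae_of_all _ fun s => ?_)
  rw [Real.norm_of_nonneg (by positivity)]
  nlinarith [mul_nonneg (sq_nonneg s) (sq_nonneg (psi (p k) s))]

/-- For `k = l` the square is controlled by the weighted moment of `ψ_k²`; for `k ≠ l` independence
factors it into two finite moments. -/
theorem SourceAssumptions.memLp_psi_mul (hp : SourceAssumptions p) (k l : Fin d) :
    MemLp (fun s => psi (p k) (s k) * s l) 2 (sourceLaw p) := by
  have := hp.continuous_psi k
  refine (memLp_two_iff_integrable_sq (Continuous.aestronglyMeasurable (by fun_prop))).2 ?_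
  rcases eq_or_ne k l with rfl | hkl
  · refine hp.integrable_eval (f := fun s => (psi (p k) s * s) ^ 2) ?_
    refine (hp.moment_psi k).mono' (by fun_prop) (ae_of_all _ fun s => ?_)
    rw [Real.norm_of_nonneg (by positivity)]
    nlinarith [sq_nonneg (psi (p k) s)]
  · refine (hp.integrable_mul_eval hkl (f := fun s => psi (p k) s ^ 2) (g := fun s => s ^ 2)
      (by fun_prop) (by fun_prop) (hp.integrable_psi_sq k) (hp.moment_sq l)).congr
      (ae_of_all _ fun s => by ring)

theorem SourceAssumptions.integrable_deriv_psi_mul_sq (hp : SourceAssumptions p) (k l : Fin d) :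
    Integrable (fun s => |deriv (psi (p k)) (s k)| * s l ^ 2) (sourceLaw p) := by
  have := hp.continuous_deriv_psi k
  rcases eq_or_ne k l with rfl | hkl
  · refine hp.integrable_eval (f := fun s => |deriv (psi (p k)) s| * s ^ 2) ?_
    refine (hp.moment_dpsi k).mono' (by fun_prop) (ae_of_all _ fun s => ?_)
    rw [Real.norm_of_nonneg (by positivity)]
    nlinarith [abs_nonneg (deriv (psi (p k)) s)]
  · refine hp.integrable_mul_eval hkl (f := fun s => |deriv (psi (p k)) s|) (g := fun s => s ^ 2)
      (by fun_prop) (by fun_prop) ?_ (hp.moment_sq l)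
    refine (hp.moment_dpsi k).mono' (by fun_prop) (ae_of_all _ fun s => ?_)
    rw [Real.norm_of_nonneg (by positivity)]
    nlinarith [mul_nonneg (sq_nonneg s) (abs_nonneg (deriv (psi (p k)) s))]

/-- The bound `|s_l s_m| ≤ s_l² + s_m²` reduces mixed products to squares. -/
theorem SourceAssumptions.integrable_deriv_psi_mul (hp : SourceAssumptions p) (k l m : Fin d) :
    Integrable (fun s => deriv (psi (p k)) (s k) * (s l * s m)) (sourceLaw p) := by
  have := hp.continuous_deriv_psi k
  refine ((hp.integrable_deriv_psi_mul_sq k l).add (hp.integrable_deriv_psi_mul_sq k m)).mono'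
    (by fun_prop) (ae_of_all _ fun s => ?_)
  simp only [Pi.add_apply, ← mul_add, norm_mul, Real.norm_eq_abs]
  gcongr
  nlinarith [sq_nonneg (|s l| - |s m|), sq_abs (s l), sq_abs (s m), sq_nonneg (s l),
    sq_nonneg (s m)]

/-! ### Moments of the relative score and Hessian -/

/-- The Kronecker delta. -/
def kron (i j : Fin d) : ℝ := if i = j then 1 else 0

/-- The relative score coordinates `δ_il + ψ_i(s_i) s_l`. -/
def relScore (p : Fin d → ℝ → ℝ) (i l : Fin d) (s : Fin d → ℝ) : ℝ :=
  kron i l + psi (p i) (s i) * s l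

/-- The relative Hessian coordinates `-δ_im δ_kl + δ_ik ψ_i'(s_i) s_l s_m`. -/
def relHess (p : Fin d → ℝ → ℝ) (i l k m : Fin d) (s : Fin d → ℝ) : ℝ :=
  -(kron i m * kron k l)
    + kron i k * (deriv (psi (p i)) (s i) * (s l * s m))

theorem SourceAssumptions.continuous_relScore (hp : SourceAssumptions p) (i l : Fin d) :
    Continuous (relScore p i l) := by
  have := hp.continuous_psi i
  unfold relScore
  fun_prop

theorem SourceAssumptions.continuous_relHess (hp : SourceAssumptions p) (i l k m : Fin d) :
    Continuous (relHess p i l k m) := by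
  have := hp.continuous_deriv_psi i
  unfold relHess
  fun_prop

theorem SourceAssumptions.memLp_relScore (hp : SourceAssumptions p) (i l : Fin d) :
    MemLp (relScore p i l) 2 (sourceLaw p) := by
  have := hp.isProbabilityMeasure_sourceLaw
  unfold relScore
  have h : MemLp (fun _ : Fin d → ℝ => kron i l) 2 (sourceLaw p) := memLp_const _
  exact h.add (hp.memLp_psi_mul i l)

theorem SourceAssumptions.integrable_relHess (hp : SourceAssumptions p) (i l k m : Fin d) :
    Integrable (relHess p i l k m) (sourceLaw p) := by
  have := hp.isProbabilityMeasure_sourceLaw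
  unfold relHess
  exact (integrable_const _).fun_add ((hp.integrable_deriv_psi_mul i l m).const_mul _)

theorem hasDerivAt_update_apply (s : Fin d → ℝ) (i k : Fin d) (t : ℝ) :
    HasDerivAt (fun t => Function.update s i t k) (kron i k) t := by
  have h := (hasDerivAt_pi.1 (hasDerivAt_update s i t)) k
  rwa [show (Pi.single i (1 : ℝ) : Fin d → ℝ) k = kron i k by
    simp [kron, Pi.single_apply, eq_comm]] at h

/-- `E[ψ_i(S_i) S_l] = -δ_il`. -/
theorem SourceAssumptions.integral_psi_mul (hp : SourceAssumptions p) (i l : Fin d) :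
    ∫ s, psi (p i) (s i) * s l ∂(sourceLaw p) = -kron i l := by
  have := hp.isProbabilityMeasure_sourceLaw
  have hi := (hp.memLp_psi_mul i l).integrable (by norm_num)
  have h := hp.integral_psi_mul_add_partial i (f := fun s => s l)
    (f' := fun _ => kron i l)
    (fun s => hasDerivAt_update_apply s i l (s i)) ((hp.memLp_eval l).integrable (by norm_num))
    (hi.fun_add (integrable_const _))
  rw [integral_add hi (integrable_const _), integral_const] at h
  simp only [probReal_univ, one_smul] at h
  linarith

theorem SourceAssumptions.integral_relScore (hp : SourceAssumptions p) (i l : Fin d) :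
    ∫ s, relScore p i l s ∂(sourceLaw p) = 0 := by
  have := hp.isProbabilityMeasure_sourceLaw
  unfold relScore
  rw [integral_add (integrable_const _) ((hp.memLp_psi_mul i l).integrable (by norm_num)),
    hp.integral_psi_mul, integral_const]
  simp

/-- The information identity in relative coordinates. -/
theorem SourceAssumptions.integral_relScore_mul (hp : SourceAssumptions p) (i l k m : Fin d) :
    ∫ s, relScore p i l s * relScore p k m s ∂(sourceLaw p)
      = -∫ s, relHess p i l k m s ∂(sourceLaw p) := by
  have := hp.isProbabilityMeasure_sourceLaw
  have hil := (hp.memLp_psi_mul i l).integrable (q := 2) (by norm_num)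
  have hkm := (hp.memLp_psi_mul k m).integrable (q := 2) (by norm_num)
  have hkl := (hp.memLp_psi_mul k l).integrable (q := 2) (by norm_num)
  have hd := hp.integrable_deriv_psi_mul k l m
  have hf : Integrable (fun s => psi (p k) (s k) * s l * s m) (sourceLaw p) :=
    (hp.memLp_psi_mul k l).integrable_mul (hp.memLp_eval m)
  have hpp : Integrable (fun s => (psi (p i) (s i) * s l) * (psi (p k) (s k) * s m)) (sourceLaw p) :=
    (hp.memLp_psi_mul i l).integrable_mul (hp.memLp_psi_mul k m)
  have hf' : Integrable (fun s => kron i k * (deriv (psi (p k)) (s k) * (s l * s m))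
      + kron i l * (psi (p k) (s k) * s m) + kron i m * (psi (p k) (s k) * s l)) (sourceLaw p) :=
    ((hd.const_mul _).fun_add (hkm.const_mul _)).fun_add (hkl.const_mul _)
  have hpf : Integrable (fun s => psi (p i) (s i) * (psi (p k) (s k) * s l * s m)) (sourceLaw p) :=
    hpp.congr (ae_of_all _ fun s => by ring)
  -- With this `f`, the term `ψ_i f` is the product of the nonconstant parts of the two scores, and
  -- `∂_i f` produces the Hessian term and two first moments already known.
  have hstein := hp.integral_psi_mul_add_partial i (f := fun s => psi (p k) (s k) * s l * s m)
    (f' := fun s => kron i k * (deriv (psi (p k)) (s k) * (s l * s m))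
      + kron i l * (psi (p k) (s k) * s m) + kron i m * (psi (p k) (s k) * s l))
    (fun s => by
      have hψ : HasDerivAt (psi (p k)) (deriv (psi (p k)) (Function.update s i (s i) k))
          (Function.update s i (s i) k) :=
        ((hp.contDiff_psi k).differentiable (by norm_num) _).hasDerivAt
      have h1 := (hψ.comp (s i) (hasDerivAt_update_apply s i k (s i))).mul
        (hasDerivAt_update_apply s i l (s i)) |>.mul (hasDerivAt_update_apply s i m (s i))
      refine h1.congr_deriv ?_
      simp
      ring) hf (hpf.fun_add hf')
  rw [integral_add hpf hf',
    integral_add ((hd.const_mul _).fun_add (hkm.const_mul _)) (hkl.const_mul _),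
    integral_add (hd.const_mul _) (hkm.const_mul _), integral_const_mul, integral_const_mul,
    integral_const_mul, hp.integral_psi_mul, hp.integral_psi_mul] at hstein
  have hL : ∫ s, relScore p i l s * relScore p k m s ∂(sourceLaw p)
      = -(kron i l * kron k m) + ∫ s, psi (p i) (s i) * (psi (p k) (s k) * s l * s m) ∂(sourceLaw p) := by
    have e : (fun s => relScore p i l s * relScore p k m s) = fun s =>
        ((kron i l * kron k m + kron i l * (psi (p k) (s k) * s m)) + kron k m * (psi (p i) (s i) * s l))
          + psi (p i) (s i) * (psi (p k) (s k) * s l * s m) := by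
      funext s; simp only [relScore]; ring
    rw [e, integral_add
        (((integrable_const _).fun_add (hkm.const_mul _)).fun_add (hil.const_mul _)) hpf,
      integral_add ((integrable_const _).fun_add (hkm.const_mul _)) (hil.const_mul _),
      integral_add (integrable_const _) (hkm.const_mul _),
      integral_const_mul (kron i l) fun s : Fin d → ℝ => psi (p k) (s k) * s m,
      integral_const_mul (kron k m) fun s : Fin d → ℝ => psi (p i) (s i) * s l,
      hp.integral_psi_mul, hp.integral_psi_mul, integral_const]
    simp
    ring
  have hR : ∫ s, relHess p i l k m s ∂(sourceLaw p)
      = -(kron i m * kron k l) + kron i k * ∫ s, deriv (psi (p k)) (s k) * (s l * s m) ∂(sourceLaw p) := by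
    -- Stein's identity yields `ψ_k'` where `relHess` has `ψ_i'`; the factor `kron i k` makes them
    -- interchangeable.
    have e : relHess p i l k m = fun s =>
        -(kron i m * kron k l) + kron i k * (deriv (psi (p k)) (s k) * (s l * s m)) := by
      funext s
      simp only [relHess]
      rcases eq_or_ne i k with rfl | hik
      · rfl
      · simp [kron, hik]
    rw [e, integral_add (integrable_const _) (hd.const_mul _), integral_const_mul, integral_const]
    simp
  rw [hL, hR]
  linarith

/-! ### The log-determinant -/

/-- The log-determinant part of the log-likelihood. -/
def logDet (θ : Param d) : ℝ := Real.log |(matW θ).det|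

theorem contDiff_matW_apply {n : WithTop ℕ∞} (i j : Fin d) :
    ContDiff ℝ n fun θ : Param d => matW θ i j :=
  contDiff_piLp_apply (i := (j, i)) 2

theorem contDiff_det_matW {n : WithTop ℕ∞} : ContDiff ℝ n fun θ : Param d => (matW θ).det := by
  simp only [Matrix.det_apply]
  refine ContDiff.sum fun σ _ => ContDiff.const_smul _ (contDiff_prod fun i _ => ?_)
  exact contDiff_matW_apply _ _

theorem contDiffAt_logDet {n : WithTop ℕ∞} {θ : Param d} (hθ : (matW θ).det ≠ 0) :
    ContDiffAt ℝ n logDet θ := by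
  -- `Real.log` is even, so the absolute value can be dropped and both signs of the determinant are
  -- treated at once.
  have : (logDet : Param d → ℝ) = fun θ => Real.log (matW θ).det := by
    funext θ; rw [logDet, Real.log_abs]
  rw [this]
  exact contDiff_det_matW.contDiffAt.log hθ

theorem eventually_det_matW_ne_zero {θ : Param d} (hθ : (matW θ).det ≠ 0) :
    ∀ᶠ η in 𝓝 θ, (matW η).det ≠ 0 :=
  (contDiff_det_matW (n := 0)).continuous.continuousAt.eventually_ne hθ

theorem _root_.HasFDerivAt.hasDerivAt_line {E F : Type*} [NormedAddCommGroup E] [NormedSpace ℝ E]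
    [NormedAddCommGroup F] [NormedSpace ℝ F] {f : E → F} {f' : E →L[ℝ] F} {x : E}
    (hf : HasFDerivAt f f' x) (a : E) : HasDerivAt (fun t : ℝ => f (x + t • a)) (f' a) 0 := by
  have hl : HasDerivAt (fun t : ℝ => x + t • a) a 0 := by
    simpa using ((hasDerivAt_id (0 : ℝ)).smul_const a).const_add x
  exact HasFDerivAt.comp_hasDerivAt_of_eq 0 hf hl (by simp)

/-- Restriction to lines lets uniqueness of one-variable derivatives identify second derivatives. -/
theorem hasDerivAt_fderiv_line {E : Type*} [NormedAddCommGroup E] [NormedSpace ℝ E] {f : E → ℝ}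
    {x : E} (hf : ContDiffAt ℝ 2 f x) (a b : E) :
    HasDerivAt (fun t : ℝ => fderiv ℝ f (x + t • a) b) (fderiv ℝ (fderiv ℝ f) x a b) 0 := by
  have hd : DifferentiableAt ℝ (fderiv ℝ f) x :=
    (hf.fderiv_right (m := 1) (by norm_num)).differentiableAt (by norm_num)
  exact (ContinuousLinearMap.apply ℝ ℝ b).hasFDerivAt.comp_hasDerivAt 0
    (hd.hasFDerivAt.hasDerivAt_line a)

theorem tendsto_line {E : Type*} [NormedAddCommGroup E] [NormedSpace ℝ E] (x a : E) :
    Tendsto (fun t : ℝ => x + t • a) (𝓝 0) (𝓝 x) := by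
  simpa using ((hasFDerivAt_id x).hasDerivAt_line a).continuousAt.tendsto

theorem hasDerivAt_det_add_smul {W : Matrix (Fin d) (Fin d) ℝ} (hW : W.det ≠ 0)
    (H : Matrix (Fin d) (Fin d) ℝ) :
    HasDerivAt (fun t : ℝ => (W + t • H).det) (W.det * (W⁻¹ * H).trace) 0 := by
  -- After factoring out `W`, `det (1 + t A)` is a polynomial in `t` with constant term `1` and
  -- linear coefficient `trace A`; `divX.divX` collects the higher terms.
  have e : (fun t : ℝ => (W + t • H).det) = fun t => W.det * (1 + (W⁻¹ * H).trace * t +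
      (Matrix.det (1 + (Polynomial.X : Polynomial ℝ) • (W⁻¹ * H).map Polynomial.C)).divX.divX.eval t
        * t ^ 2) := by
    funext t
    rw [← Matrix.det_one_add_smul, ← Matrix.det_mul, mul_add, mul_one, Matrix.mul_smul,
      ← mul_assoc, Matrix.mul_nonsing_inv _ (Ne.isUnit hW), one_mul]
  rw [e]
  have h := ((((hasDerivAt_id (0 : ℝ)).const_mul (W⁻¹ * H).trace).const_add 1).add
    ((Polynomial.hasDerivAt
      (Matrix.det (1 + (Polynomial.X : Polynomial ℝ) • (W⁻¹ * H).map Polynomial.C)).divX.divX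
      0).mul (hasDerivAt_pow 2 (0 : ℝ)))).const_mul W.det
  refine h.congr_deriv ?_
  simp

theorem fderiv_logDet {θ : Param d} (hθ : (matW θ).det ≠ 0) (h : Param d) :
    fderiv ℝ logDet θ h = ((matW θ)⁻¹ * matW h).trace := by
  have h1 : HasDerivAt (fun t : ℝ => logDet (θ + t • h)) (fderiv ℝ logDet θ h) 0 :=
    ((contDiffAt_logDet (n := 1) hθ).differentiableAt (by norm_num)).hasFDerivAt.hasDerivAt_line h
  have h2 := (hasDerivAt_det_add_smul hθ (matW h)).log (by simpa using hθ)
  have e : (fun t : ℝ => logDet (θ + t • h))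
      = fun t => Real.log (matW θ + t • matW h).det := by
    funext t; rw [logDet, Real.log_abs]; rfl
  rw [e] at h1
  rw [h1.unique h2]
  simp [mul_div_cancel_left₀ _ hθ]

theorem fderiv_fderiv_logDet {θ : Param d} (hθ : (matW θ).det ≠ 0) (a b : Param d) :
    fderiv ℝ (fderiv ℝ logDet) θ a b
      = -((matW θ)⁻¹ * matW a * (matW θ)⁻¹ * matW b).trace := by
  refine (hasDerivAt_fderiv_line (contDiffAt_logDet hθ) a b).unique ?_
  set W := matW θ
  have hc : Tendsto (fun t : ℝ => θ + t • a) (𝓝 0) (𝓝 θ) := tendsto_line θ a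
  have hev : ∀ᶠ t : ℝ in 𝓝 0, (W + t • matW a).det ≠ 0 :=
    hc.eventually (eventually_det_matW_ne_zero hθ)
  have heq : (fun t : ℝ => fderiv ℝ logDet (θ + t • a) b) =ᶠ[𝓝 0]
      fun t => ((W + t • matW a)⁻¹ * matW b).trace := by
    filter_upwards [hev] with t ht
    exact fderiv_logDet (θ := θ + t • a) ht b
  refine HasDerivAt.congr_of_eventuallyEq ?_ heq
  rw [hasDerivAt_iff_tendsto_slope]
  have hinv : ContinuousAt (fun t : ℝ => (W + t • matW a)⁻¹) 0 := by
    have h1 : Continuous fun t : ℝ => W + t • matW a :=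
      continuous_const.add (continuous_id.smul continuous_const)
    simp only [Matrix.inv_def]
    have h2 : ContinuousAt (fun t : ℝ => Ring.inverse (W + t • matW a).det) 0 := by
      simp only [Ring.inverse_eq_inv']
      exact h1.matrix_det.continuousAt.inv₀ (by simpa using hθ)
    exact h2.smul h1.matrix_adjugate.continuousAt
  have hlim : Tendsto (fun t : ℝ => -((W + t • matW a)⁻¹ * matW a * W⁻¹ * matW b).trace)
      (𝓝[≠] 0) (𝓝 (-(W⁻¹ * matW a * W⁻¹ * matW b).trace)) := by
    have h1 : ContinuousAt
        (fun t : ℝ => -((W + t • matW a)⁻¹ * matW a * W⁻¹ * matW b).trace) 0 := by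
      have hF : Continuous fun M : Matrix (Fin d) (Fin d) ℝ =>
          -(M * matW a * W⁻¹ * matW b).trace := by fun_prop
      exact hF.continuousAt.comp hinv
    have h2 := h1.tendsto
    simp only [zero_smul, add_zero] at h2
    exact h2.mono_left nhdsWithin_le_nhds
  refine hlim.congr' ?_
  filter_upwards [self_mem_nhdsWithin, nhdsWithin_le_nhds hev] with t ht hdet
  have ht : t ≠ 0 := ht
  -- The resolvent identity makes the difference quotient explicit, so continuity of the inverse
  -- suffices for the limit.
  have hdiff : (W + t • matW a)⁻¹ - W⁻¹ = -t • ((W + t • matW a)⁻¹ * matW a * W⁻¹) := by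
    have h1 : (W + t • matW a)⁻¹ * (W + t • matW a) = 1 :=
      Matrix.nonsing_inv_mul _ (Ne.isUnit hdet)
    have h2 : W * W⁻¹ = 1 := Matrix.mul_nonsing_inv _ (Ne.isUnit hθ)
    calc (W + t • matW a)⁻¹ - W⁻¹
        = (W + t • matW a)⁻¹ * (W * W⁻¹)
          - (W + t • matW a)⁻¹ * (W + t • matW a) * W⁻¹ := by rw [h1, h2, mul_one, one_mul]
      _ = _ := by
        simp only [mul_add, add_mul, Matrix.mul_smul, Matrix.smul_mul, mul_assoc, neg_smul]
        abel
  rw [slope_def_field, ← Matrix.trace_sub]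
  simp only [zero_smul, add_zero, sub_zero]
  rw [← Matrix.sub_mul, hdiff, Matrix.smul_mul, Matrix.trace_smul, smul_eq_mul]
  field_simp

/-! ### The log-likelihood of one observation -/

/-- The linear functional `θ ↦ w_kᵀ x`. -/
def rowDot (x : Fin d → ℝ) (k : Fin d) : Param d →L[ℝ] ℝ :=
  ∑ j, x j • EuclideanSpace.proj (𝕜 := ℝ) (j, k)

theorem rowDot_apply (x : Fin d → ℝ) (k : Fin d) (θ : Param d) :
    rowDot x k θ = (matW θ *ᵥ x) k := by
  simp [rowDot, matW, mulVec, dotProduct, mul_comm]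

theorem abs_rowDot_le (x : Fin d → ℝ) (k : Fin d) (θ : Param d) :
    |rowDot x k θ| ≤ ‖θ‖ * ∑ j, |x j| := by
  rw [rowDot_apply, mulVec, dotProduct, Finset.mul_sum]
  refine (Finset.abs_sum_le_sum_abs _ _).trans (Finset.sum_le_sum fun j _ => ?_)
  rw [abs_mul]
  gcongr
  exact PiLp.norm_apply_le θ (j, k)

theorem rowDot_single (x : Fin d → ℝ) (k i j : Fin d) :
    rowDot x k (EuclideanSpace.single (j, i) 1) = kron i k * x j := by
  rw [rowDot_apply, mulVec, dotProduct]
  rcases eq_or_ne i k with rfl | h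
  · simp [matW, kron]
  · simp [matW, kron, h, h.symm]

theorem matW_single (i j : Fin d) :
    matW (EuclideanSpace.single (j, i) 1) = Matrix.single i j 1 := by
  ext a b
  simp [matW, Matrix.single_apply, PiLp.single_apply, and_comm, eq_comm]

theorem logLik_eq (p : Fin d → ℝ → ℝ) (x : Fin d → ℝ) :
    logLik p x = fun θ => logDet θ + ∑ k, Real.log (p k (rowDot x k θ)) := by
  funext θ
  simp only [logLik, logDet, rowDot_apply]

theorem SourceAssumptions.contDiff_log (hp : SourceAssumptions p) (k : Fin d) :
    ContDiff ℝ 3 fun s => Real.log (p k s) :=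
  (hp.contDiff k).log fun s => (hp.pos k s).ne'

theorem SourceAssumptions.contDiffAt_logLik (hp : SourceAssumptions p) {θ : Param d}
    (hθ : (matW θ).det ≠ 0) (x : Fin d → ℝ) : ContDiffAt ℝ 3 (logLik p x) θ := by
  rw [logLik_eq]
  exact (contDiffAt_logDet hθ).add (ContDiffAt.sum fun k _ =>
    ((hp.contDiff_log k).comp (rowDot x k).contDiff).contDiffAt)

theorem SourceAssumptions.fderiv_logLik (hp : SourceAssumptions p) {θ : Param d}
    (hθ : (matW θ).det ≠ 0) (x : Fin d → ℝ) (h : Param d) :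
    fderiv ℝ (logLik p x) θ h
      = fderiv ℝ logDet θ h + ∑ k, psi (p k) (rowDot x k θ) * rowDot x k h := by
  have h1 := ((contDiffAt_logDet (n := 1) hθ).differentiableAt (by norm_num)).hasFDerivAt
  have h2 (k : Fin d) : HasFDerivAt (fun θ => Real.log (p k (rowDot x k θ)))
      (psi (p k) (rowDot x k θ) • rowDot x k) θ :=
    (((hp.contDiff_log k).differentiable (by norm_num) _).hasDerivAt).comp_hasFDerivAt θ
      (rowDot x k).hasFDerivAt
  have h3 := h1.fun_add (HasFDerivAt.fun_sum fun k (_ : k ∈ Finset.univ) => h2 k)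
  rw [logLik_eq, h3.fderiv]
  simp

theorem SourceAssumptions.fderiv_fderiv_logLik (hp : SourceAssumptions p) {θ : Param d}
    (hθ : (matW θ).det ≠ 0) (x : Fin d → ℝ) (a b : Param d) :
    fderiv ℝ (fderiv ℝ (logLik p x)) θ a b
      = fderiv ℝ (fderiv ℝ logDet) θ a b
        + ∑ k, deriv (psi (p k)) (rowDot x k θ) * (rowDot x k a * rowDot x k b) := by
  refine (hasDerivAt_fderiv_line ((hp.contDiffAt_logLik hθ x).of_le (by norm_num)) a b).unique ?_
  have hc : Tendsto (fun t : ℝ => θ + t • a) (𝓝 0) (𝓝 θ) := tendsto_line θ a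
  have heq : (fun t : ℝ => fderiv ℝ (logLik p x) (θ + t • a) b) =ᶠ[𝓝 0] fun t =>
      fderiv ℝ logDet (θ + t • a) b
        + ∑ k, psi (p k) (rowDot x k (θ + t • a)) * rowDot x k b := by
    filter_upwards [hc.eventually (eventually_det_matW_ne_zero hθ)] with t ht
    exact hp.fderiv_logLik ht x b
  refine HasDerivAt.congr_of_eventuallyEq ?_ heq
  have h1 := hasDerivAt_fderiv_line (contDiffAt_logDet (n := 2) hθ) a b
  have h2 (k : Fin d) : HasDerivAt
      (fun t : ℝ => psi (p k) (rowDot x k (θ + t • a)) * rowDot x k b)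
      (deriv (psi (p k)) (rowDot x k θ) * (rowDot x k a * rowDot x k b)) 0 := by
    have hψ := ((hp.contDiff_psi k).differentiable (by norm_num)
      (rowDot x k (θ + (0 : ℝ) • a))).hasDerivAt
    have hl : HasDerivAt (fun t : ℝ => rowDot x k (θ + t • a)) (rowDot x k a) 0 :=
      (rowDot x k).hasFDerivAt.hasDerivAt_line a
    have h := (hψ.comp 0 hl).mul_const (rowDot x k b)
    simp only [zero_smul, add_zero, mul_assoc] at h
    exact h
  exact h1.add (HasDerivAt.fun_sum fun k _ => h2 k)

theorem score_apply (p : Fin d → ℝ → ℝ) (θ : Param d) (x : Fin d → ℝ) (a : Fin d × Fin d) :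
    score p θ x a = fderiv ℝ (logLik p x) θ (EuclideanSpace.single a 1) := by
  have h : inner ℝ (gradient (logLik p x) θ) (EuclideanSpace.single a 1)
      = fderiv ℝ (logLik p x) θ (EuclideanSpace.single a 1) := by
    rw [gradient, InnerProductSpace.toDual_symm_apply]
  rw [← h, score, EuclideanSpace.inner_single_right]
  simp

theorem inner_score (p : Fin d → ℝ → ℝ) (θ h : Param d) (x : Fin d → ℝ) :
    inner ℝ h (score p θ x) = fderiv ℝ (logLik p x) θ h := by
  rw [real_inner_comm, score, gradient, InnerProductSpace.toDual_symm_apply]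

theorem dotProduct_hessian (p : Fin d → ℝ → ℝ) (θ h : Param d) (x : Fin d → ℝ) :
    h.ofLp ⬝ᵥ hessian p θ x *ᵥ h.ofLp = fderiv ℝ (fderiv ℝ (logLik p x)) θ h h := by
  have hh : h = ∑ a, h a • EuclideanSpace.single a (1 : ℝ) := by
    ext b
    simp [Pi.single_apply]
  conv_rhs => rw [hh]
  simp only [map_sum, map_smul, _root_.sum_apply, _root_.smul_apply,
    dotProduct, mulVec, hessian, Matrix.of_apply, smul_eq_mul, Finset.mul_sum]
  rw [Finset.sum_comm]
  exact Finset.sum_congr rfl fun a _ => Finset.sum_congr rfl fun b _ => by ring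

/-! ### Score and Hessian at `W₀` in source coordinates -/

variable {W₀ : Matrix (Fin d) (Fin d) ℝ}

theorem inv_mulVec_mulVec (hW₀ : W₀.det ≠ 0) (x : Fin d → ℝ) : W₀⁻¹ *ᵥ (W₀ *ᵥ x) = x := by
  rw [Matrix.mulVec_mulVec, Matrix.nonsing_inv_mul _ (Ne.isUnit hW₀), Matrix.one_mulVec]

theorem apply_eq_sum_inv (hW₀ : W₀.det ≠ 0) (x : Fin d → ℝ) (j : Fin d) :
    x j = ∑ l, W₀⁻¹ j l * (W₀ *ᵥ x) l :=
  (congrFun (inv_mulVec_mulVec hW₀ x) j).symm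

/-- Substituting `x = W₀⁻¹ s` gives the log-determinant gradient and the source terms the same
coefficients `W₀⁻¹ j l`, which reduces moments of the score to those of `relScore`. -/
theorem SourceAssumptions.score_eq (hp : SourceAssumptions p) (hW₀ : W₀.det ≠ 0)
    (x : Fin d → ℝ) (j i : Fin d) :
    score p (vecW W₀) x (j, i) = ∑ l, W₀⁻¹ j l * relScore p i l (W₀ *ᵥ x) := by
  have hθ : (matW (vecW W₀)).det ≠ 0 := hW₀
  rw [score_apply, hp.fderiv_logLik hθ, fderiv_logDet hθ, matW_single, matW_vecW]
  simp only [rowDot_single, relScore, mul_add, Finset.sum_add_distrib]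
  congr 1
  · rw [Matrix.trace_mul_single]
    simp [kron]
  · rw [Finset.sum_eq_single i (fun k _ hk => by simp [kron, hk.symm]) (by simp)]
    simp only [rowDot_apply, matW_vecW]
    conv_lhs => rw [apply_eq_sum_inv hW₀ x j]
    simp only [kron, if_true, one_mul, Finset.mul_sum]
    exact Finset.sum_congr rfl fun l _ => by ring

/-- The constant part of `relHess` comes from `-tr(W₀⁻¹ A W₀⁻¹ B)`. The `ψ'` part appears only for
equal row indices, since each row enters a single source term. -/
theorem SourceAssumptions.hessian_eq (hp : SourceAssumptions p) (hW₀ : W₀.det ≠ 0)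
    (x : Fin d → ℝ) (j i j' i' : Fin d) :
    hessian p (vecW W₀) x (j, i) (j', i')
      = ∑ l, ∑ m, W₀⁻¹ j l * W₀⁻¹ j' m * relHess p i l i' m (W₀ *ᵥ x) := by
  have hθ : (matW (vecW W₀)).det ≠ 0 := hW₀
  rw [hessian, Matrix.of_apply, hp.fderiv_fderiv_logLik hθ, fderiv_fderiv_logDet hθ, matW_single,
    matW_single, matW_vecW]
  simp only [rowDot_single, relHess, mul_add, Finset.sum_add_distrib]
  congr 1
  · rw [Matrix.trace_mul_single]
    have h1 : (W₀⁻¹ * (Matrix.single i j 1 : Matrix (Fin d) (Fin d) ℝ) * W₀⁻¹) j' i' = W₀⁻¹ j' i * W₀⁻¹ j i' := by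
      simp [Matrix.mul_apply, Matrix.single_apply, ite_and]
    rw [h1]
    simp [kron]
    ring
  · rw [Finset.sum_eq_single i (fun k _ hk => by simp [kron, hk.symm]) (by simp)]
    simp only [rowDot_apply, matW_vecW]
    conv_lhs => rw [apply_eq_sum_inv hW₀ x j, apply_eq_sum_inv hW₀ x j']
    rcases eq_or_ne i i' with rfl | h
    · simp only [kron, if_true, one_mul]
      rw [Finset.sum_mul_sum, Finset.mul_sum]
      simp only [Finset.mul_sum]
      exact Finset.sum_congr rfl fun l _ => Finset.sum_congr rfl fun m _ => by ring
    · simp [kron, h, h.symm]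

/-! ### The Fisher information -/

theorem measurePreserving_mulVec (p : Fin d → ℝ → ℝ) (hW₀ : W₀.det ≠ 0) :
    MeasurePreserving (fun x => W₀ *ᵥ x) (dataLaw p W₀) (sourceLaw p) := by
  have hm (M : Matrix (Fin d) (Fin d) ℝ) : Measurable fun x : Fin d → ℝ => M *ᵥ x :=
    Continuous.measurable (by fun_prop)
  refine ⟨hm _, ?_⟩
  rw [dataLaw, Measure.map_map (hm _) (hm _)]
  have e : ((fun x => W₀ *ᵥ x) ∘ fun s => W₀⁻¹ *ᵥ s) = id := by
    funext s
    simp [Matrix.mulVec_mulVec, Matrix.mul_nonsing_inv _ (Ne.isUnit hW₀)]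
  rw [e, Measure.map_id]

theorem SourceAssumptions.isProbabilityMeasure_dataLaw (hp : SourceAssumptions p)
    (W₀ : Matrix (Fin d) (Fin d) ℝ) : IsProbabilityMeasure (dataLaw p W₀) := by
  have := hp.isProbabilityMeasure_sourceLaw
  exact Measure.isProbabilityMeasure_map (Continuous.aemeasurable (by fun_prop))

theorem integral_dataLaw (p : Fin d → ℝ → ℝ) (hW₀ : W₀.det ≠ 0) {f : (Fin d → ℝ) → ℝ}
    (hf : Continuous f) :
    ∫ x, f (W₀ *ᵥ x) ∂(dataLaw p W₀) = ∫ s, f s ∂(sourceLaw p) :=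
  (measurePreserving_mulVec p hW₀).hasLaw.integral_comp hf.aestronglyMeasurable

theorem integrable_dataLaw (hW₀ : W₀.det ≠ 0) {f : (Fin d → ℝ) → ℝ}
    (hf : Integrable f (sourceLaw p)) : Integrable (fun x => f (W₀ *ᵥ x)) (dataLaw p W₀) :=
  (measurePreserving_mulVec p hW₀).integrable_comp_of_integrable hf

theorem SourceAssumptions.continuous_score_apply (hp : SourceAssumptions p) (hW₀ : W₀.det ≠ 0)
    (a : Fin d × Fin d) : Continuous fun x => score p (vecW W₀) x a := by
  simp only [fun x => hp.score_eq hW₀ x a.1 a.2]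
  have h (l : Fin d) := hp.continuous_relScore a.2 l
  fun_prop

theorem SourceAssumptions.continuous_score (hp : SourceAssumptions p) (hW₀ : W₀.det ≠ 0) :
    Continuous (score p (vecW W₀)) :=
  (PiLp.continuous_toLp 2 _).comp (continuous_pi (hp.continuous_score_apply hW₀))

theorem SourceAssumptions.memLp_score (hp : SourceAssumptions p) (hW₀ : W₀.det ≠ 0)
    (a : Fin d × Fin d) : MemLp (fun x => score p (vecW W₀) x a) 2 (dataLaw p W₀) := by
  simp only [fun x => hp.score_eq hW₀ x a.1 a.2]
  exact memLp_finsetSum _ fun l _ =>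
    ((hp.memLp_relScore a.2 l).comp_measurePreserving (measurePreserving_mulVec p hW₀)).const_mul _

theorem SourceAssumptions.integral_score (hp : SourceAssumptions p) (hW₀ : W₀.det ≠ 0)
    (a : Fin d × Fin d) : ∫ x, score p (vecW W₀) x a ∂(dataLaw p W₀) = 0 := by
  have := hp.isProbabilityMeasure_sourceLaw
  simp only [fun x => hp.score_eq hW₀ x a.1 a.2]
  rw [integral_finsetSum _ fun l _ => (integrable_dataLaw hW₀
    ((hp.memLp_relScore a.2 l).integrable (by norm_num))).const_mul _]
  refine Finset.sum_eq_zero fun l _ => ?_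
  rw [integral_const_mul, integral_dataLaw p hW₀ (hp.continuous_relScore _ _),
    hp.integral_relScore, mul_zero]

theorem SourceAssumptions.continuous_hessian (hp : SourceAssumptions p) (hW₀ : W₀.det ≠ 0)
    (a b : Fin d × Fin d) : Continuous fun x => hessian p (vecW W₀) x a b := by
  simp only [fun x => hp.hessian_eq hW₀ x a.1 a.2 b.1 b.2]
  have h (l m : Fin d) := hp.continuous_relHess a.2 l b.2 m
  fun_prop

theorem SourceAssumptions.integrable_hessian (hp : SourceAssumptions p) (hW₀ : W₀.det ≠ 0)
    (a b : Fin d × Fin d) :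
    Integrable (fun x => hessian p (vecW W₀) x a b) (dataLaw p W₀) := by
  simp only [fun x => hp.hessian_eq hW₀ x a.1 a.2 b.1 b.2]
  exact integrable_finsetSum _ fun l _ => integrable_finsetSum _ fun m _ =>
    (integrable_dataLaw hW₀ (hp.integrable_relHess _ _ _ _)).const_mul _

/-- The information identity: the covariance of the score is minus the mean Hessian. -/
theorem SourceAssumptions.fisherInfo_eq (hp : SourceAssumptions p) (hW₀ : W₀.det ≠ 0)
    (a b : Fin d × Fin d) :
    fisherInfo p W₀ a b = -∫ x, hessian p (vecW W₀) x a b ∂(dataLaw p W₀) := by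
  have := hp.isProbabilityMeasure_dataLaw W₀
  have hint (l m : Fin d) : Integrable
      (fun s => relScore p a.2 l s * relScore p b.2 m s) (sourceLaw p) :=
    (hp.memLp_relScore a.2 l).integrable_mul (hp.memLp_relScore b.2 m)
  rw [fisherInfo, Matrix.of_apply, covariance_eq_sub (hp.memLp_score hW₀ a) (hp.memLp_score hW₀ b),
    hp.integral_score hW₀, zero_mul, sub_zero]
  have e (x : Fin d → ℝ) : ((fun x => score p (vecW W₀) x a) * fun x => score p (vecW W₀) x b) x
      = ∑ l, ∑ m, W₀⁻¹ a.1 l * W₀⁻¹ b.1 m *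
        (relScore p a.2 l (W₀ *ᵥ x) * relScore p b.2 m (W₀ *ᵥ x)) := by
    simp only [Pi.mul_apply]
    rw [hp.score_eq hW₀ x a.1 a.2, hp.score_eq hW₀ x b.1 b.2, Finset.sum_mul_sum]
    exact Finset.sum_congr rfl fun l _ => Finset.sum_congr rfl fun m _ => by ring
  simp only [e, fun x => hp.hessian_eq hW₀ x a.1 a.2 b.1 b.2]
  rw [integral_finsetSum _ fun l _ => integrable_finsetSum _ fun m _ =>
      (integrable_dataLaw hW₀ (hint l m)).const_mul _,
    integral_finsetSum _ fun l _ => integrable_finsetSum _ fun m _ =>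
      (integrable_dataLaw hW₀ (hp.integrable_relHess _ _ _ _)).const_mul _,
    ← Finset.sum_neg_distrib]
  refine Finset.sum_congr rfl fun l _ => ?_
  rw [integral_finsetSum _ fun m _ => (integrable_dataLaw hW₀ (hint l m)).const_mul _,
    integral_finsetSum _ fun m _ =>
      (integrable_dataLaw hW₀ (hp.integrable_relHess _ _ _ _)).const_mul _,
    ← Finset.sum_neg_distrib]
  refine Finset.sum_congr rfl fun m _ => ?_
  rw [integral_const_mul, integral_const_mul,
    integral_dataLaw p hW₀ (f := fun s => relScore p a.2 l s * relScore p b.2 m s)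
      ((hp.continuous_relScore _ _).mul (hp.continuous_relScore _ _)),
    integral_dataLaw p hW₀ (hp.continuous_relHess _ _ _ _), hp.integral_relScore_mul, mul_neg]

/-- The quadratic form at `t` is the variance of `∑ t_a Y_a`. -/
theorem posSemidef_covariance {ι α : Type*} [Fintype ι] [MeasurableSpace α] {μ : Measure α}
    [IsFiniteMeasure μ] {Y : ι → α → ℝ} (hY : ∀ a, MemLp (Y a) 2 μ) :
    (Matrix.of fun a b => covariance (Y a) (Y b) μ).PosSemidef := by
  refine Matrix.PosSemidef.of_dotProduct_mulVec_nonneg ?_ fun t => ?_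
  · ext a b
    simp [covariance_comm (Y a)]
  · have hL : MemLp (fun x => ∑ a, t a * Y a x) 2 μ :=
      memLp_finsetSum _ fun a _ => (hY a).const_mul _
    have h := variance_nonneg (fun x => ∑ a, t a * Y a x) μ
    rw [← covariance_self hL.1.aemeasurable,
      covariance_fun_sum_fun_sum (fun a => (hY a).const_mul _) fun a => (hY a).const_mul _] at h
    refine h.trans_eq ?_
    simp only [covariance_const_mul_left, covariance_const_mul_right, dotProduct, mulVec,
      Finset.mul_sum, Matrix.of_apply, star_trivial]
    exact Finset.sum_congr rfl fun a _ => Finset.sum_congr rfl fun b _ => by ring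

theorem SourceAssumptions.posSemidef_fisherInfo (hp : SourceAssumptions p) (hW₀ : W₀.det ≠ 0) :
    (fisherInfo p W₀).PosSemidef :=
  have := hp.isProbabilityMeasure_dataLaw W₀
  posSemidef_covariance (hp.memLp_score hW₀)

theorem SourceAssumptions.tendstoInDistribution_normScore (hp : SourceAssumptions p)
    (hW₀ : W₀.det ≠ 0) {Ω : Type*} [MeasurableSpace Ω] {P : Measure Ω} [IsProbabilityMeasure P]
    {X : ℕ → Ω → Fin d → ℝ} (hX : ∀ i, HasLaw (X i) (dataLaw p W₀) P) (hindep : iIndepFun X P) :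
    TendstoInDistribution
      (fun N ω => normScore p (vecW W₀) N (fun i => X i ω)) atTop id (fun _ => P)
      (multivariateGaussian 0 (fisherInfo p W₀)) := by
  have hm := (hp.continuous_score hW₀).measurable
  refine tendstoInDistribution_multivariateGaussian (Z := fun i ω => score p (vecW W₀) (X i ω))
    (hindep.comp (fun _ => score p (vecW W₀)) fun _ => hm)
    (fun i => ((hX i).identDistrib (hX 0)).comp hm) (fun a => ?_) (fun a => ?_)
    (hp.posSemidef_fisherInfo hW₀) fun a b => ?_
  · have h := hp.memLp_score hW₀ a
    rw [← (hX 0).map_eq] at h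
    exact h.comp_of_map (hX 0).aemeasurable
  · rw [← hp.integral_score hW₀ a]
    exact (hX 0).integral_comp (hp.continuous_score_apply hW₀ a).aestronglyMeasurable
  · exact ((hX 0).covariance_fun_comp (hp.continuous_score_apply hW₀ a).aemeasurable
      (hp.continuous_score_apply hW₀ b).aemeasurable).symm

/-- The strong law of large numbers for a function of i.i.d. variables with a given law. -/
theorem ae_tendsto_average {α Ω : Type*} [MeasurableSpace α] {ν : Measure α} [MeasurableSpace Ω]
    {P : Measure Ω} {X : ℕ → Ω → α} (hX : ∀ i, HasLaw (X i) ν P)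
    (hindep : iIndepFun X P) {f : α → ℝ} (hf : Integrable f ν) :
    ∀ᵐ ω ∂P, Tendsto (fun N : ℕ => (∑ i ∈ Finset.range N, f (X i ω)) / N) atTop
      (𝓝 (∫ x, f x ∂ν)) := by
  have hm i : AEMeasurable f (P.map (X i)) := (hX i).map_eq ▸ hf.1.aemeasurable
  have h := strong_law_ae_real (μ := P) (fun i ω => f (X i ω)) ?_
    (fun i j hij => (hindep.comp₀ (fun _ => f) (fun i => (hX i).aemeasurable) hm).indepFun hij)
    fun i => ((hX i).identDistrib (hX 0)).comp_of_aemeasurable (hm i)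
  · rwa [show ∫ ω, f (X 0 ω) ∂P = ∫ x, f x ∂ν from (hX 0).integral_comp hf.1] at h
  · rw [← (hX 0).map_eq] at hf
    exact hf.comp_aemeasurable (hX 0).aemeasurable

/-! ### The remainder of the expansion -/

/-- The second-order Taylor remainder of the log-determinant. -/
def logDetRemainder (θ v : Param d) : ℝ :=
  logDet (θ + v) - logDet θ - fderiv ℝ logDet θ v - 1 / 2 * fderiv ℝ (fderiv ℝ logDet) θ v v

/-- Since `‖h / √N‖² = ‖h‖² / N`, a remainder `o(‖v‖²)` repeated `N` times still vanishes, uniformly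
on the ball. -/
theorem eventually_logDetRemainder_le (hW₀ : W₀.det ≠ 0) (R : ℝ) {ε : ℝ} (hε : 0 < ε) :
    ∀ᶠ N : ℕ in atTop, ∀ h : Param d, ‖h‖ ≤ R →
      N * |logDetRemainder (vecW W₀) ((√(N : ℝ))⁻¹ • h)| ≤ ε := by
  have hθ : (matW (vecW W₀)).det ≠ 0 := hW₀
  -- The `+ 1` keeps the denominator positive when `R = 0`.
  have hc : 0 < ε / (R ^ 2 + 1) := by positivity
  have ho := (taylor_two_isLittleO (contDiffAt_logDet (n := 2) hθ)).def hc
  obtain ⟨r, hr, hball⟩ := Metric.eventually_nhds_iff_ball.1 ho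
  have hlim : Tendsto (fun N : ℕ => (√(N : ℝ))⁻¹ * R) atTop (𝓝 0) := by
    simpa using (tendsto_inv_atTop_zero.comp
      (Real.tendsto_sqrt_atTop.comp tendsto_natCast_atTop_atTop)).mul_const R
  filter_upwards [hlim.eventually_lt_const hr, eventually_gt_atTop 0] with N hN hN0 h hh
  have hN0' : (0 : ℝ) < N := by exact_mod_cast hN0
  have hnorm : ‖(√(N : ℝ))⁻¹ • h‖ = (√(N : ℝ))⁻¹ * ‖h‖ := by
    rw [norm_smul, Real.norm_of_nonneg (by positivity)]
  have hmem : (√(N : ℝ))⁻¹ • h ∈ Metric.ball (0 : Param d) r := by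
    rw [mem_ball_zero_iff, hnorm]
    exact (mul_le_mul_of_nonneg_left hh (by positivity)).trans_lt hN
  have hb := hball _ hmem
  rw [Real.norm_of_nonneg (by positivity : 0 ≤ ‖(√(N : ℝ))⁻¹ • h‖ ^ 2), hnorm, mul_pow, inv_pow,
    Real.sq_sqrt hN0'.le] at hb
  have hh2 : ‖h‖ ^ 2 ≤ R ^ 2 := pow_le_pow_left₀ (norm_nonneg _) hh 2
  calc N * |logDetRemainder (vecW W₀) ((√(N : ℝ))⁻¹ • h)|
      ≤ N * (ε / (R ^ 2 + 1) * ((N : ℝ)⁻¹ * ‖h‖ ^ 2)) := by gcongr; exact hb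
    _ = ε / (R ^ 2 + 1) * ‖h‖ ^ 2 := by field_simp
    _ ≤ ε / (R ^ 2 + 1) * (R ^ 2 + 1) := by gcongr; linarith
    _ = ε := by field_simp

/-- A bound for the norm of `x ↦ W₀⁻¹ x` from the Euclidean to the `ℓ¹` norm. -/
def invBound (W₀ : Matrix (Fin d) (Fin d) ℝ) : ℝ := ∑ j, ∑ l, |W₀⁻¹ j l|

theorem invBound_nonneg (W₀ : Matrix (Fin d) (Fin d) ℝ) : 0 ≤ invBound W₀ :=
  Finset.sum_nonneg fun _ _ => Finset.sum_nonneg fun _ _ => abs_nonneg _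

theorem sum_abs_le (hW₀ : W₀.det ≠ 0) (x : Fin d → ℝ) :
    ∑ j, |x j| ≤ invBound W₀ * ‖WithLp.toLp 2 (W₀ *ᵥ x)‖ := by
  rw [invBound, Finset.sum_mul]
  refine Finset.sum_le_sum fun j _ => ?_
  rw [apply_eq_sum_inv hW₀ x j, Finset.sum_mul]
  refine (Finset.abs_sum_le_sum_abs _ _).trans (Finset.sum_le_sum fun l _ => ?_)
  rw [abs_mul]
  gcongr
  exact PiLp.norm_apply_le (WithLp.toLp 2 (W₀ *ᵥ x)) l

/-- The third-order envelope `(1 + ‖s‖³) ∑_k G_k(s_k)`. -/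
def envelopeSum (G : Fin d → ℝ → ℝ) (s : Fin d → ℝ) : ℝ :=
  (1 + ‖WithLp.toLp 2 s‖ ^ 3) * ∑ k, G k (s k)

/-- Taylor expansion of one log-likelihood with a cubic remainder. -/
theorem SourceAssumptions.abs_logLik_sub_le (hp : SourceAssumptions p) (hW₀ : W₀.det ≠ 0)
    {δ : ℝ} {G : Fin d → ℝ → ℝ} (hδ : 0 < δ)
    (hG : ∀ k s u, |u - s| ≤ δ → |deriv (deriv (psi (p k))) u| ≤ G k s) (x : Fin d → ℝ)
    (v : Param d) (hv : ‖v‖ * (invBound W₀ * ‖WithLp.toLp 2 (W₀ *ᵥ x)‖) ≤ δ) :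
    |logLik p x (vecW W₀ + v) - logLik p x (vecW W₀) - inner ℝ v (score p (vecW W₀) x)
        - 1 / 2 * (v.ofLp ⬝ᵥ hessian p (vecW W₀) x *ᵥ v.ofLp) - logDetRemainder (vecW W₀) v|
      ≤ (‖v‖ * invBound W₀) ^ 3 * envelopeSum G (W₀ *ᵥ x) := by
  have hθ : (matW (vecW W₀)).det ≠ 0 := hW₀
  set s := W₀ *ᵥ x with hs
  have hr (k : Fin d) : rowDot x k (vecW W₀) = s k := by rw [rowDot_apply, matW_vecW]
  have hu (k : Fin d) : |rowDot x k v| ≤ ‖v‖ * (invBound W₀ * ‖WithLp.toLp 2 s‖) :=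
    (abs_rowDot_le x k v).trans (by gcongr; exact sum_abs_le hW₀ x)
  -- The log-determinant cancels exactly against its own remainder, leaving one scalar Taylor
  -- remainder of `log p_k` per source.
  have e : logLik p x (vecW W₀ + v) - logLik p x (vecW W₀) - inner ℝ v (score p (vecW W₀) x)
        - 1 / 2 * (v.ofLp ⬝ᵥ hessian p (vecW W₀) x *ᵥ v.ofLp) - logDetRemainder (vecW W₀) v
      = ∑ k, (Real.log (p k (s k + rowDot x k v)) - Real.log (p k (s k))
          - psi (p k) (s k) * rowDot x k v
          - 1 / 2 * deriv (psi (p k)) (s k) * rowDot x k v ^ 2) := by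
    rw [inner_score, dotProduct_hessian, hp.fderiv_logLik hθ, hp.fderiv_fderiv_logLik hθ,
      logLik_eq, logDetRemainder]
    simp only [map_add, hr, Finset.sum_sub_distrib]
    have h2 : ∑ k, 1 / 2 * deriv (psi (p k)) (s k) * rowDot x k v ^ 2
        = 1 / 2 * ∑ k, deriv (psi (p k)) (s k) * (rowDot x k v * rowDot x k v) := by
      rw [Finset.mul_sum]
      exact Finset.sum_congr rfl fun k _ => by ring
    rw [h2]
    ring
  rw [e, envelopeSum, Finset.mul_sum, Finset.mul_sum]
  refine (Finset.abs_sum_le_sum_abs _ _).trans (Finset.sum_le_sum fun k _ => ?_)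
  -- The envelope condition at `u = s` already forces nonnegativity.
  have hG0 : 0 ≤ G k (s k) := (abs_nonneg _).trans (hG k (s k) (s k) (by simpa using hδ.le))
  refine (abs_taylor_two_le (hp.contDiff_log k) (a := s k) (u := rowDot x k v) (C := G k (s k))
    fun y hy => hG k (s k) y (hy.trans ((hu k).trans hv))).trans ?_
  calc G k (s k) * |rowDot x k v| ^ 3
      ≤ G k (s k) * (‖v‖ * (invBound W₀ * ‖WithLp.toLp 2 s‖)) ^ 3 := by gcongr; exact hu k
    _ = (‖v‖ * invBound W₀) ^ 3 * (‖WithLp.toLp 2 s‖ ^ 3 * G k (s k)) := by ring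
    _ ≤ (‖v‖ * invBound W₀) ^ 3 * ((1 + ‖WithLp.toLp 2 s‖ ^ 3) * G k (s k)) := by
      have := invBound_nonneg W₀
      gcongr
      linarith

/-- The random part of the bound for the remainder. -/
def remainderBound (p : Fin d → ℝ → ℝ) (W₀ : Matrix (Fin d) (Fin d) ℝ) (G : Fin d → ℝ → ℝ) (R : ℝ)
    (N : ℕ) (x : ℕ → Fin d → ℝ) : ℝ :=
  (R * invBound W₀) ^ 3 * (√(N : ℝ))⁻¹ *
      ((∑ i ∈ Finset.range N, envelopeSum G (W₀ *ᵥ x i)) / N)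
    + 1 / 2 * R ^ 2 * ∑ a, ∑ b,
      |(∑ i ∈ Finset.range N, hessian p (vecW W₀) (x i) a b) / N + fisherInfo p W₀ a b|

theorem abs_dotProduct_mulVec_le {ι : Type*} [Fintype ι] (M : Matrix ι ι ℝ)
    (h : EuclideanSpace ℝ ι) {R : ℝ} (hh : ‖h‖ ≤ R) :
    |h.ofLp ⬝ᵥ M *ᵥ h.ofLp| ≤ R ^ 2 * ∑ a, ∑ b, |M a b| := by
  have hR : 0 ≤ R := (norm_nonneg _).trans hh
  have ha (a : ι) : |h a| ≤ R := (PiLp.norm_apply_le h a).trans hh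
  simp only [dotProduct, mulVec, Finset.mul_sum]
  refine (Finset.abs_sum_le_sum_abs _ _).trans (Finset.sum_le_sum fun a _ => ?_)
  refine (Finset.abs_sum_le_sum_abs _ _).trans (Finset.sum_le_sum fun b _ => ?_)
  rw [abs_mul, abs_mul]
  calc |h a| * (|M a b| * |h b|) ≤ R * (|M a b| * R) := by gcongr <;> exact ha _
    _ = R ^ 2 * |M a b| := by ring

/-- The linear terms cancel against `S_N`. What remains is the log-determinant part, the cubic
terms, each of size `N^{-3/2}` times its envelope, and half the quadratic form of the averaged
Hessian plus `I`. -/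
theorem SourceAssumptions.abs_lanRemainder_le (hp : SourceAssumptions p) (hW₀ : W₀.det ≠ 0)
    {δ : ℝ} {G : Fin d → ℝ → ℝ} (hδ : 0 < δ)
    (hG : ∀ k s u, |u - s| ≤ δ → |deriv (deriv (psi (p k))) u| ≤ G k s) {R : ℝ} {N : ℕ}
    (hN : 0 < N) (x : ℕ → Fin d → ℝ)
    (hx : ∀ i < N, R * invBound W₀ * ‖WithLp.toLp 2 (W₀ *ᵥ x i)‖ ≤ δ * √(N : ℝ))
    (h : Param d) (hh : ‖h‖ ≤ R) :
    |lanRemainder p W₀ N x h| ≤ N * |logDetRemainder (vecW W₀) ((√(N : ℝ))⁻¹ • h)|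
      + remainderBound p W₀ G R N x := by
  have hN0 : (0 : ℝ) < N := by exact_mod_cast hN
  have hsq : 0 < √(N : ℝ) := Real.sqrt_pos.2 hN0
  have hR : 0 ≤ R := (norm_nonneg _).trans hh
  have hC := invBound_nonneg W₀
  set v : Param d := (√(N : ℝ))⁻¹ • h with hvdef
  have hvn : ‖v‖ ≤ (√(N : ℝ))⁻¹ * R := by
    rw [hvdef, norm_smul, Real.norm_of_nonneg (by positivity)]
    gcongr
  have hsq3 : ((√(N : ℝ))⁻¹) ^ 3 = (√(N : ℝ))⁻¹ * (N : ℝ)⁻¹ := by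
    rw [pow_succ', inv_pow, Real.sq_sqrt hN0.le]
  set D : ℕ → ℝ := fun i =>
    logLik p (x i) (vecW W₀ + v) - logLik p (x i) (vecW W₀) - inner ℝ v (score p (vecW W₀) (x i))
        - 1 / 2 * (v.ofLp ⬝ᵥ hessian p (vecW W₀) (x i) *ᵥ v.ofLp) - logDetRemainder (vecW W₀) v
  have hD : ∀ i ∈ Finset.range N,
      |D i| ≤ (R * invBound W₀) ^ 3 * (√(N : ℝ))⁻¹ * (envelopeSum G (W₀ *ᵥ x i) / N) := by
    intro i hi
    have hxi := hx i (Finset.mem_range.1 hi)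
    have hE : 0 ≤ envelopeSum G (W₀ *ᵥ x i) := mul_nonneg (by positivity)
      (Finset.sum_nonneg fun k _ => (abs_nonneg _).trans
        (hG k _ _ (by simpa using hδ.le : |(W₀ *ᵥ x i) k - (W₀ *ᵥ x i) k| ≤ δ)))
    refine (hp.abs_logLik_sub_le hW₀ hδ hG (x i) v ?_).trans ?_
    · calc ‖v‖ * (invBound W₀ * ‖WithLp.toLp 2 (W₀ *ᵥ x i)‖)
          ≤ (√(N : ℝ))⁻¹ * R * (invBound W₀ * ‖WithLp.toLp 2 (W₀ *ᵥ x i)‖) := by gcongr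
        _ = (√(N : ℝ))⁻¹ * (R * invBound W₀ * ‖WithLp.toLp 2 (W₀ *ᵥ x i)‖) := by ring
        _ ≤ (√(N : ℝ))⁻¹ * (δ * √(N : ℝ)) := by gcongr
        _ = δ := by field_simp
    · calc (‖v‖ * invBound W₀) ^ 3 * envelopeSum G (W₀ *ᵥ x i)
          ≤ ((√(N : ℝ))⁻¹ * R * invBound W₀) ^ 3 * envelopeSum G (W₀ *ᵥ x i) := by gcongr
        _ = (R * invBound W₀) ^ 3 * ((√(N : ℝ))⁻¹) ^ 3 * envelopeSum G (W₀ *ᵥ x i) := by ring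
        _ = _ := by rw [hsq3]; ring
  set M : Matrix (Fin d × Fin d) (Fin d × Fin d) ℝ := Matrix.of fun a b =>
    (∑ i ∈ Finset.range N, hessian p (vecW W₀) (x i) a b) / N + fisherInfo p W₀ a b with hM
  have hquad : ∑ i ∈ Finset.range N, v.ofLp ⬝ᵥ hessian p (vecW W₀) (x i) *ᵥ v.ofLp
      = h.ofLp ⬝ᵥ M *ᵥ h.ofLp - h.ofLp ⬝ᵥ fisherInfo p W₀ *ᵥ h.ofLp := by
    have hMe : M = (N : ℝ)⁻¹ • ∑ i ∈ Finset.range N, hessian p (vecW W₀) (x i)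
        + fisherInfo p W₀ := by
      ext a b
      simp [hM, Matrix.sum_apply, div_eq_inv_mul]
    have hvv : v.ofLp = (√(N : ℝ))⁻¹ • h.ofLp := rfl
    have hsq2 : (√(N : ℝ))⁻¹ * (√(N : ℝ))⁻¹ = (N : ℝ)⁻¹ := by
      rw [← mul_inv, Real.mul_self_sqrt hN0.le]
    rw [hMe, Matrix.add_mulVec, dotProduct_add, add_sub_cancel_right, Matrix.smul_mulVec,
      dotProduct_smul, Matrix.sum_mulVec, dotProduct_sum, Finset.smul_sum]
    refine Finset.sum_congr rfl fun i _ => ?_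
    rw [hvv, Matrix.mulVec_smul, smul_dotProduct, dotProduct_smul, smul_smul, hsq2]
  have hinner : ∑ i ∈ Finset.range N, inner ℝ v (score p (vecW W₀) (x i))
      = inner ℝ h (normScore p (vecW W₀) N x) := by
    rw [← inner_sum, hvdef, real_inner_smul_left, normScore, real_inner_smul_right]
  have hsum : lanRemainder p W₀ N x h = ∑ i ∈ Finset.range N, D i
      + N * logDetRemainder (vecW W₀) v + 1 / 2 * (h.ofLp ⬝ᵥ M *ᵥ h.ofLp) := by
    simp only [D, Finset.sum_sub_distrib, ← Finset.mul_sum, hquad, hinner, Finset.sum_const,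
      Finset.card_range, nsmul_eq_mul, lanRemainder, sampleLogLik]
    ring
  have h1 : |∑ i ∈ Finset.range N, D i| ≤ (R * invBound W₀) ^ 3 * (√(N : ℝ))⁻¹ *
      ((∑ i ∈ Finset.range N, envelopeSum G (W₀ *ᵥ x i)) / N) := by
    rw [Finset.sum_div, Finset.mul_sum]
    exact (Finset.abs_sum_le_sum_abs _ _).trans (Finset.sum_le_sum hD)
  have h2 : |1 / 2 * (h.ofLp ⬝ᵥ M *ᵥ h.ofLp)| ≤ 1 / 2 * R ^ 2 * ∑ a, ∑ b, |M a b| := by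
    rw [abs_mul, abs_of_pos (by norm_num : (0 : ℝ) < 1 / 2), mul_assoc]
    gcongr
    exact abs_dotProduct_mulVec_le M h hh
  have h3 : |N * logDetRemainder (vecW W₀) v| = N * |logDetRemainder (vecW W₀) v| := by
    rw [abs_mul, abs_of_pos hN0]
  rw [hsum, remainderBound, ← h3]
  refine (abs_add_three _ _ _).trans ?_
  have h2' : |1 / 2 * (h.ofLp ⬝ᵥ M *ᵥ h.ofLp)| ≤ 1 / 2 * R ^ 2 * ∑ a, ∑ b,
      |(∑ i ∈ Finset.range N, hessian p (vecW W₀) (x i) a b) / N + fisherInfo p W₀ a b| := h2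
  linarith

/-- This is `max ‖S_i‖ = o(√N)` in probability: a union bound over identically distributed terms
leaves `N · P(‖S‖² ≥ c N)`, which vanishes because `E‖S‖² < ∞`. -/
theorem SourceAssumptions.tendsto_measure_exists_gt (hp : SourceAssumptions p) (hW₀ : W₀.det ≠ 0)
    {Ω : Type*} [MeasurableSpace Ω] {P : Measure Ω} {X : ℕ → Ω → Fin d → ℝ}
    (hX : ∀ i, HasLaw (X i) (dataLaw p W₀) P) {C δ : ℝ} (hC : 0 ≤ C) (hδ : 0 < δ) :
    Tendsto (fun N : ℕ => P {ω | ∃ i < N, δ * √(N : ℝ) < C * ‖WithLp.toLp 2 (W₀ *ᵥ X i ω)‖})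
      atTop (𝓝 0) := by
  have := hp.isProbabilityMeasure_sourceLaw
  -- Using `C + 1` keeps `c` meaningful when `C = 0`.
  set c := δ ^ 2 / (C + 1) ^ 2
  have hc : 0 < c := by positivity
  let Y : (Fin d → ℝ) → ℝ := fun s => ∑ k, s k ^ 2
  have hY : Integrable Y (sourceLaw p) :=
    integrable_finsetSum _ fun k _ => (hp.memLp_eval k).integrable_sq
  have hYm : Measurable Y := by fun_prop
  have hlaw (i : ℕ) : HasLaw (fun ω => W₀ *ᵥ X i ω) (sourceLaw p) P :=
    (measurePreserving_mulVec p hW₀).hasLaw.comp (hX i)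
  refine tendsto_of_tendsto_of_tendsto_of_le_of_le tendsto_const_nhds
    (tendsto_mul_measure_ge hY hYm hc) (fun _ => bot_le) fun N => ?_
  have hsub : {ω | ∃ i < N, δ * √(N : ℝ) < C * ‖WithLp.toLp 2 (W₀ *ᵥ X i ω)‖}
      ⊆ ⋃ i ∈ Finset.range N, {ω | c * N ≤ Y (W₀ *ᵥ X i ω)} := by
    rintro ω ⟨i, hi, h⟩
    refine Set.mem_biUnion (Finset.mem_coe.2 (Finset.mem_range.2 hi)) ?_
    have hn : Y (W₀ *ᵥ X i ω) = ‖WithLp.toLp 2 (W₀ *ᵥ X i ω)‖ ^ 2 := by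
      rw [EuclideanSpace.real_norm_sq_eq]
    have h1 : δ * √(N : ℝ) ≤ (C + 1) * ‖WithLp.toLp 2 (W₀ *ᵥ X i ω)‖ := by
      nlinarith [norm_nonneg (WithLp.toLp 2 (W₀ *ᵥ X i ω))]
    have h2 := pow_le_pow_left₀ (by positivity) h1 2
    rw [mul_pow, mul_pow, Real.sq_sqrt (Nat.cast_nonneg _), ← hn] at h2
    show δ ^ 2 / (C + 1) ^ 2 * N ≤ _
    rw [div_mul_eq_mul_div, div_le_iff₀ (by positivity)]
    linarith
  calc P {ω | ∃ i < N, δ * √(N : ℝ) < C * ‖WithLp.toLp 2 (W₀ *ᵥ X i ω)‖}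
      ≤ ∑ i ∈ Finset.range N, P {ω | c * N ≤ Y (W₀ *ᵥ X i ω)} :=
        (measure_mono hsub).trans (measure_biUnion_finset_le _ _)
    _ = ∑ i ∈ Finset.range N, sourceLaw p {s | c * N ≤ Y s} :=
        Finset.sum_congr rfl fun i _ =>
          (hlaw i).measure_eq (measurableSet_le measurable_const hYm)
    _ = N * sourceLaw p {s | c * N ≤ Y s} := by simp

variable {Ω : Type*} [MeasurableSpace Ω] {P : Measure Ω} [IsProbabilityMeasure P]
  {X : ℕ → Ω → Fin d → ℝ}

/-- The averaged envelope converges almost surely and carries a factor `N^{-1/2}`; the averaged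
Hessian converges to `-I` by the information identity. -/
theorem SourceAssumptions.tendstoInMeasure_remainderBound (hp : SourceAssumptions p)
    (hW₀ : W₀.det ≠ 0) (hX : ∀ i, HasLaw (X i) (dataLaw p W₀) P) (hindep : iIndepFun X P)
    {G : Fin d → ℝ → ℝ} (hG : Integrable (envelopeSum G) (sourceLaw p)) (R : ℝ) :
    TendstoInMeasure P (fun N ω => remainderBound p W₀ G R N fun i => X i ω) atTop
      fun _ => (0 : ℝ) := by
  have hF := integrable_dataLaw hW₀ hG
  have hmF (i : ℕ) : AEMeasurable (fun ω => envelopeSum G (W₀ *ᵥ X i ω)) P := by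
    have h := hF.1.aemeasurable
    rw [← (hX i).map_eq] at h
    exact h.comp_aemeasurable (hX i).aemeasurable
  have hmH (i : ℕ) (a b : Fin d × Fin d) :
      AEMeasurable (fun ω => hessian p (vecW W₀) (X i ω) a b) P :=
    (hp.continuous_hessian hW₀ a b).measurable.comp_aemeasurable (hX i).aemeasurable
  refine tendstoInMeasure_of_tendsto_ae (fun N => ?_) ?_
  · unfold remainderBound
    exact AEMeasurable.aestronglyMeasurable (by fun_prop)
  · have hH : ∀ᵐ ω ∂P, ∀ a b, Tendsto
        (fun N : ℕ => (∑ i ∈ Finset.range N, hessian p (vecW W₀) (X i ω) a b) / N) atTop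
        (𝓝 (∫ x, hessian p (vecW W₀) x a b ∂(dataLaw p W₀))) :=
      ae_all_iff.2 fun a => ae_all_iff.2 fun b =>
        ae_tendsto_average hX hindep (hp.integrable_hessian hW₀ a b)
    filter_upwards [ae_tendsto_average hX hindep hF, hH] with ω h1 h2
    have hs : Tendsto (fun N : ℕ => (√(N : ℝ))⁻¹) atTop (𝓝 0) :=
      tendsto_inv_atTop_zero.comp (Real.tendsto_sqrt_atTop.comp tendsto_natCast_atTop_atTop)
    have h3 := (hs.const_mul ((R * invBound W₀) ^ 3)).mul h1
    have h4 := (tendsto_finsetSum Finset.univ fun a _ => tendsto_finsetSum Finset.univ fun b _ =>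
      ((h2 a b).add_const (fisherInfo p W₀ a b)).abs).const_mul (1 / 2 * R ^ 2)
    have h5 := h3.add h4
    simpa [remainderBound, hp.fisherInfo_eq hW₀] using h5

theorem SourceAssumptions.tendsto_measure_lanRemainder (hp : SourceAssumptions p)
    (hW₀ : W₀.det ≠ 0) (hX : ∀ i, HasLaw (X i) (dataLaw p W₀) P) (hindep : iIndepFun X P)
    {R ε : ℝ} (hR : 0 < R) (hε : 0 < ε) :
    Tendsto (fun N => P {ω | ∃ h : Param d, ‖h‖ ≤ R ∧
      ε ≤ |lanRemainder p W₀ N (fun i => X i ω) h|}) atTop (𝓝 0) := by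
  obtain ⟨δ, hδ, G, hG, hGi⟩ := hp.envelope
  have hA := hp.tendstoInMeasure_remainderBound hW₀ hX hindep hGi R (ENNReal.ofReal (ε / 2))
    (by simpa using hε)
  have hB := hp.tendsto_measure_exists_gt hW₀ hX (C := R * invBound W₀)
    (mul_nonneg hR.le (invBound_nonneg W₀)) hδ
  refine tendsto_of_tendsto_of_tendsto_of_le_of_le' tendsto_const_nhds
    (by simpa only [add_zero] using hB.add hA) (Eventually.of_forall fun _ => bot_le) ?_
  -- The budget is `ε / 4` for the deterministic part and less than `ε / 2` for the random part.
  filter_upwards [eventually_logDetRemainder_le hW₀ R (by positivity : 0 < ε / 4),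
    eventually_gt_atTop 0] with N hdet hN
  -- Off the two exceptional events the bound holds for all `h` at once. Monotonicity and
  -- subadditivity need no measurability of the event quantified over `h`.
  refine (measure_mono ?_).trans (measure_union_le _ _)
  rintro ω ⟨h, hh, hε'⟩
  by_contra hcon
  rw [Set.mem_union, not_or] at hcon
  obtain ⟨hc1, hc2⟩ := hcon
  have hx : ∀ i < N, R * invBound W₀ * ‖WithLp.toLp 2 (W₀ *ᵥ X i ω)‖ ≤ δ * √(N : ℝ) := by
    intro i hi
    by_contra hlt
    exact hc1 ⟨i, hi, not_le.1 hlt⟩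
  have hb := hp.abs_lanRemainder_le hW₀ hδ hG hN (fun i => X i ω) hx h hh
  have hQ : remainderBound p W₀ G R N (fun i => X i ω) < ε / 2 := by
    by_contra hge
    refine hc2 ?_
    show ENNReal.ofReal (ε / 2) ≤ edist _ (0 : ℝ)
    rw [edist_dist, dist_zero_right]
    exact ENNReal.ofReal_le_ofReal ((not_lt.1 hge).trans (le_abs_self _))
  linarith [hdet h hh]

end

end ICA

theorem mainTheorem2 {d : ℕ} (p : Fin d → ℝ → ℝ) (hp : ICA.SourceAssumptions p)
    (W₀ : Matrix (Fin d) (Fin d) ℝ) (hW₀ : W₀.det ≠ 0)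
    {Ω : Type*} [MeasurableSpace Ω] (P : Measure Ω) [IsProbabilityMeasure P]
    (X : ℕ → Ω → Fin d → ℝ) (hX : ∀ i, HasLaw (X i) (ICA.dataLaw p W₀) P)
    (hindep : iIndepFun X P) :
    -- the score is square integrable, and its covariance matrix is minus the mean Hessian
    (∀ a, MemLp (fun x => ICA.score p (ICA.vecW W₀) x a) 2 (ICA.dataLaw p W₀)) ∧
    (∀ a b, Integrable (fun x => ICA.hessian p (ICA.vecW W₀) x a b) (ICA.dataLaw p W₀) ∧
      ICA.fisherInfo p W₀ a b
        = -∫ x, ICA.hessian p (ICA.vecW W₀) x a b ∂(ICA.dataLaw p W₀)) ∧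
    -- the normalized score converges in law to the centred Gaussian with covariance `I`
    (ICA.fisherInfo p W₀).PosSemidef ∧
    TendstoInDistribution
      (fun N ω => ICA.normScore p (ICA.vecW W₀) N (fun i => X i ω)) atTop id (fun _ => P)
      (multivariateGaussian 0 (ICA.fisherInfo p W₀)) ∧
    -- the remainder tends to zero in probability, uniformly over every ball
    (∀ R > 0, ∀ ε > 0,
      Tendsto (fun N => P {ω | ∃ h : ICA.Param d, ‖h‖ ≤ R ∧
        ε ≤ |ICA.lanRemainder p W₀ N (fun i => X i ω) h|}) atTop (𝓝 0)) := by
  exact ⟨hp.memLp_score hW₀, fun a b => ⟨hp.integrable_hessian hW₀ a b, hp.fisherInfo_eq hW₀ a b⟩,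
    hp.posSemidef_fisherInfo hW₀, hp.tendstoInDistribution_normScore hW₀ hX hindep,
    fun R hR ε hε => hp.tendsto_measure_lanRemainder hW₀ hX hindep hR hε⟩
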